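/- Let $M$ be a compact connected 2-dimensional manifold (Hausdorff, without boundary) of class $C^4$, and let $\bar x: M\to\mathbb{R}^3$ be a $C^4$-immersion whose Gaussian curvature $K_I$ is positive everywhere (an ovaloid). Let $\bar y: M\to\mathbb{R}^3$ be a $C^1$-relative normalization of $\bar x$, i.e. a $C^1$-map such that, at every point, $\bar y$ does not lie in the tangent plane $d\bar x(TM)$, while all derivatives of $\bar y$ lie in it. Let $\bar\xi$ be the unit normal of $\bar x$ with $\langle\bar\xi,\bar y\rangle>0$, let $h_{ij}=\langle\bar\xi,\bar x_{/ij}\rangle$ be the second fundamental form, and let $q=\langle\bar\xi,\bar y\rangle$ be the support function of $\bar y$. Let $S$ be the scalar curvature (normalized to be the Gaussian curvature) of the relative metric $G_{ij}=\langle\bar X,\bar x_{/ij}\rangle=q^{-1}h_{ij}$, where $\langle\bar X,\bar x_{/i}\rangle=0$ and $\langle\bar X,\bar y\rangle=1$. Let $\bar y_{\mathrm{aff}}=q_{\mathrm{aff}}\,\bar\xi-h^{(ij)}(q_{\mathrm{aff}})_{/i}\,\bar x_{/j}$ be the equiaffine normalization, i.e. the relative normalization with support function $q_{\mathrm{aff}}=|K_I|^{1/4}$,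 and let $S_{\mathrm{aff}}$ be the corresponding scalar curvature, i.e. that of the relative metric of $\bar y_{\mathrm{aff}}$. If the function $$\frac{S}{q}-\frac{S_{\mathrm{aff}}}{q_{\mathrm{aff}}}$$ does not change sign on $M$ (it is $\ge 0$ everywhere or $\le 0$ everywhere), then $\bar y$ and $\bar y_{\mathrm{aff}}$ are constantly proportional: there is a constant $c\neq 0$ with $\bar y=c\,\bar y_{\mathrm{aff}}$ on $M$. -/

import Mathlib

open scoped Manifold ContDiff

noncomputable section

namespace RelGeom

/-- The coordinate plane. -/
abbrev E2 : Type := EuclideanSpace ℝ (Fin 2)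

/-- Euclidean 3-space. -/
abbrev E3 : Type := EuclideanSpace ℝ (Fin 3)

/-- The partial derivative with respect to the `i`-th coordinate. -/
def pderiv {F : Type*} [NormedAddCommGroup F] [NormedSpace ℝ F]
    (i : Fin 2) (f : E2 → F) (u : E2) : F :=
  fderiv ℝ f u (EuclideanSpace.single i (1 : ℝ))

/-! ### Curvature of a two-dimensional (pseudo-)Riemannian metric in coordinates -/

/-- The Christoffel symbol with upper index `k` and lower indices `i`, `j` of the metric with
coefficient matrix `G`. -/
def christoffel (G : E2 → Matrix (Fin 2) (Fin 2) ℝ) (k i j : Fin 2) (u : E2) : ℝ :=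
  (1 / 2 : ℝ) * ∑ l, (G u)⁻¹ k l *
    (pderiv i (fun v => G v j l) u + pderiv j (fun v => G v i l) u
      - pderiv l (fun v => G v i j) u)

/-- The components `R^l_{kij}` of the Riemann curvature tensor
`R(∂_i, ∂_j) ∂_k = R^l_{kij} ∂_l`. -/
def riemann (G : E2 → Matrix (Fin 2) (Fin 2) ℝ) (l k i j : Fin 2) (u : E2) : ℝ :=
  pderiv i (christoffel G l j k) u - pderiv j (christoffel G l i k) u
    + ∑ m, (christoffel G l i m u * christoffel G m j k u
      - christoffel G l j m u * christoffel G m i k u)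

/-- The Ricci tensor. -/
def ricci (G : E2 → Matrix (Fin 2) (Fin 2) ℝ) (k j : Fin 2) (u : E2) : ℝ :=
  ∑ i, riemann G i k i j u

/-- The scalar curvature of the metric `G`, normalized by the factor `1 / (n (n - 1))` with
`n = 2`, so that the unit sphere has curvature `1`: the Gaussian curvature of `G`. -/
def metricCurvature (G : E2 → Matrix (Fin 2) (Fin 2) ℝ) (u : E2) : ℝ :=
  (1 / 2 : ℝ) * ∑ j, ∑ k, (G u)⁻¹ j k * ricci G k j u

/-! ### Parametrized surfaces `r` with a transversal vector field `η` -/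

/-- The cross product `r_u × r_v` of the coordinate tangent vectors. -/
def crossNormal (r : E2 → E3) (u : E2) : E3 :=
  WithLp.toLp 2 (crossProduct (WithLp.ofLp (pderiv 0 r u)) (WithLp.ofLp (pderiv 1 r u)))

/-- The first fundamental form. -/
def firstForm (r : E2 → E3) (u : E2) : Matrix (Fin 2) (Fin 2) ℝ :=
  Matrix.of fun i j => inner ℝ (pderiv i r u) (pderiv j r u)

/-- The bilinear form `⟨N, r_{ij}⟩` for a vector `N`. -/
def normalForm (r : E2 → E3) (N : E3) (u : E2) : Matrix (Fin 2) (Fin 2) ℝ :=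
  Matrix.of fun i j => inner ℝ N (pderiv j (pderiv i r) u)

/-- The Gaussian curvature; the choice of the unit normal does not matter. -/
def localGaussCurvature (r : E2 → E3) (u : E2) : ℝ :=
  (normalForm r (‖crossNormal r u‖⁻¹ • crossNormal r u) u).det / (firstForm r u).det

/-- The covector `X` of the transversal field `η`: `⟨X, r_i⟩ = 0` and `⟨X, η⟩ = 1`. -/
def localCovector (r η : E2 → E3) (u : E2) : E3 :=
  (inner ℝ (crossNormal r u) (η u))⁻¹ • crossNormal r u

/-- The relative metric `G_{ij} = ⟨X, r_{ij}⟩`. -/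
def localRelMetric (r η : E2 → E3) (u : E2) : Matrix (Fin 2) (Fin 2) ℝ :=
  normalForm r (localCovector r η u) u

/-- The Euclidean unit normal `ξ`, with the same orientation as the covector `X`. -/
def localUnitNormal (r η : E2 → E3) (u : E2) : E3 :=
  ‖localCovector r η u‖⁻¹ • localCovector r η u

/-- The support function of the equiaffine normalization, `|K|^{1/(n+2)}` with `n = 2`. -/
def localQAff (r : E2 → E3) (u : E2) : ℝ :=
  |localGaussCurvature r u| ^ (1 / 4 : ℝ)

/-- The equiaffine normalization lying on the same side of the surface as `η`. It is the unique
relative normalization with support function `q_aff` with respect to `ξ`, namely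
`q_aff ξ - h^{(ij)} (q_aff)_i r_j`, where `h` is the second fundamental form. -/
def localEquiaffine (r η : E2 → E3) (u : E2) : E3 :=
  localQAff r u • localUnitNormal r η u
    - ∑ i, ∑ j, ((normalForm r (localUnitNormal r η u) u)⁻¹ i j * pderiv i (localQAff r) u)
        • pderiv j r u

/-! ### Surfaces `x : M → ℝ³` -/

section Manifold

variable {M : Type*} [TopologicalSpace M] [ChartedSpace E2 M]

/-- `f` in the coordinates of the preferred chart around `p`. -/
def localRep {F : Type*} (f : M → F) (p : M) : E2 → F := fun u => f ((chartAt E2 p).symm u)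

/-- The coordinates of `p` in the preferred chart around `p`. -/
def coord (p : M) : E2 := chartAt E2 p p

/-- `x` is a `C^k`-immersion of the surface `M` into Euclidean 3-space. -/
structure IsImmersedSurface (k : WithTop ℕ∞) (x : M → E3) : Prop where
  contMDiff : ContMDiff (𝓡 2) (𝓡 3) k x
  injective_mfderiv : ∀ p : M, Function.Injective (mfderiv (𝓡 2) (𝓡 3) x p)

/-- `y` is a `C^k`-relative normalization of the immersed surface `x`: it is transversal to the
surface, and its derivatives are tangent to the surface. -/
structure IsRelativeNormalization (k : WithTop ℕ∞) (x y : M → E3) : Prop where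
  contMDiff : ContMDiff (𝓡 2) (𝓡 3) k y
  transversal : ∀ p : M, ¬ ∃ v : TangentSpace (𝓡 2) p,
    (mfderiv (𝓡 2) (𝓡 3) x p v : E3) = y p
  tangent : ∀ (p : M) (w : TangentSpace (𝓡 2) p), ∃ v : TangentSpace (𝓡 2) p,
    (mfderiv (𝓡 2) (𝓡 3) x p v : E3) = (mfderiv (𝓡 2) (𝓡 3) y p w : E3)

/-- The Gaussian curvature `K_I` of the surface `x`. -/
def gaussCurvature (x : M → E3) (p : M) : ℝ :=
  localGaussCurvature (localRep x p) (coord p)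

/-- The Euclidean normalization `ξ` of `x`, oriented so that `⟨ξ, y⟩ > 0`. -/
def unitNormal (x y : M → E3) (p : M) : E3 :=
  localUnitNormal (localRep x p) (localRep y p) (coord p)

/-- The support function `q = ⟨ξ, y⟩` of `y`. -/
def support (x y : M → E3) (p : M) : ℝ :=
  inner ℝ (unitNormal x y p) (y p)

/-- The function `q_aff = |K_I|^{1/4}`. -/
def qAff (x : M → E3) (p : M) : ℝ := |gaussCurvature x p| ^ (1 / 4 : ℝ)

/-- The equiaffine normalization `y_aff` of `x`, on the same side of the surface as `y`. -/
def equiaffine (x y : M → E3) (p : M) : E3 :=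
  localEquiaffine (localRep x p) (localRep y p) (coord p)

/-- The (normalized) scalar curvature `S` of the relative metric `G` of `(x, y)`. -/
def relCurvature (x y : M → E3) (p : M) : ℝ :=
  metricCurvature (localRelMetric (localRep x p) (localRep y p)) (coord p)

/-- The inner equiaffine curvature `S_aff`: the curvature of the relative metric of `y_aff`. -/
def affCurvature (x y : M → E3) (p : M) : ℝ :=
  relCurvature x (equiaffine x y) p

end Manifold

end RelGeom

end

/-! Put `w = log (q / q_aff)`. A covector that annihilates the tangent plane is fixed by its value
on a transversal vector, so the covector of `y_aff` is `(q / q_aff) X` and its relative metric is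
`exp w • G`: the two relative metrics are conformal. In dimension two a conformal change obeys
`K(exp w • G) = exp (-w) (K(G) - Δ w / 2)`, with no term quadratic in `dw`
(`metricCurvature_conformal`). Dividing by the support functions gives `S / q - S_aff / q_aff = Δ w
/ (2 q)` (`relCurvature_div_sub`), and since `q > 0` the hypothesis says that `Δ w` has a sign.

Positive Gaussian curvature makes `G` definite, so `Δ` is elliptic up to a global sign. Hopf's
strong maximum principle (`eventually_eq_of_isMaxOn`) shows that the set where `w`, up to sign,
attains its maximum is open; compactness and connectedness then make `w` constant
(`exists_logRatio_eq_const`). Finally a relative normalization can be recovered from its support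
function: pairing with `ξ` gives its normal part, pairing with the derivatives of `ξ` gives its
tangential part because `h` is nondegenerate (`IsPatch.eq_smul_localEquiaffine`).

Two points need care. The map `y` is only of class C^1, whereas `Δ w` needs second derivatives; the
tangency condition supplies the missing order (`IsPatch.contDiffAt_inner`). And every quantity on
`M` is evaluated at a point in the preferred chart of that very point, so its transformation under a
change of charts has to be known before it can be differentiated or compared nearby. -/

open scoped Topology

noncomputable section

namespace RelGeom

/-! ### Partial derivatives in the coordinate plane -/

section Calculus

variable {F : Type*} [NormedAddCommGroup F] [NormedSpace ℝ F]

theorem pderiv_congr {f g : E2 → F} {u : E2} (h : f =ᶠ[𝓝 u] g) (i : Fin 2) :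
    pderiv i f u = pderiv i g u := by
  simp only [pderiv, h.fderiv_eq]

theorem pderiv_eventuallyEq {f g : E2 → F} {u : E2} (h : f =ᶠ[𝓝 u] g) (i : Fin 2) :
    pderiv i f =ᶠ[𝓝 u] pderiv i g :=
  h.eventuallyEq_nhds.mono fun _ hv => pderiv_congr hv i

theorem pderiv_const (c : F) (i : Fin 2) (u : E2) : pderiv i (fun _ => c) u = 0 := by
  simp [pderiv]

theorem pderiv_add {f g : E2 → F} {u : E2} (hf : DifferentiableAt ℝ f u)
    (hg : DifferentiableAt ℝ g u) (i : Fin 2) :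
    pderiv i (fun v => f v + g v) u = pderiv i f u + pderiv i g u := by
  simp [pderiv, fderiv_fun_add hf hg]

theorem pderiv_sub {f g : E2 → F} {u : E2} (hf : DifferentiableAt ℝ f u)
    (hg : DifferentiableAt ℝ g u) (i : Fin 2) :
    pderiv i (fun v => f v - g v) u = pderiv i f u - pderiv i g u := by
  simp [pderiv, fderiv_fun_sub hf hg]

theorem pderiv_smul {c : E2 → ℝ} {f : E2 → F} {u : E2} (hc : DifferentiableAt ℝ c u)
    (hf : DifferentiableAt ℝ f u) (i : Fin 2) :
    pderiv i (fun v => c v • f v) u = pderiv i c u • f u + c u • pderiv i f u := by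
  simp [pderiv, fderiv_fun_smul hc hf, add_comm]

theorem pderiv_mul {f g : E2 → ℝ} {u : E2} (hf : DifferentiableAt ℝ f u)
    (hg : DifferentiableAt ℝ g u) (i : Fin 2) :
    pderiv i (fun v => f v * g v) u = pderiv i f u * g u + f u * pderiv i g u := by
  simpa using pderiv_smul hf hg i

theorem pderiv_const_mul {f : E2 → ℝ} {u : E2} (c : ℝ) (hf : DifferentiableAt ℝ f u)
    (i : Fin 2) : pderiv i (fun v => c * f v) u = c * pderiv i f u := by
  simp [pderiv_mul (differentiableAt_const c) hf, pderiv_const]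

theorem pderiv_inner {f g : E2 → E3} {u : E2} (hf : DifferentiableAt ℝ f u)
    (hg : DifferentiableAt ℝ g u) (i : Fin 2) :
    pderiv i (fun v => inner ℝ (f v) (g v)) u
      = inner ℝ (pderiv i f u) (g u) + inner ℝ (f u) (pderiv i g u) := by
  simp only [pderiv]
  rw [fderiv_inner_apply ℝ hf hg, add_comm]

theorem pderiv_exp {f : E2 → ℝ} {u : E2} (hf : DifferentiableAt ℝ f u) (i : Fin 2) :
    pderiv i (fun v => Real.exp (f v)) u = Real.exp (f u) * pderiv i f u := by
  simp [pderiv, fderiv_exp hf]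

theorem contDiffAt_pderiv {f : E2 → F} {u : E2} {m n : WithTop ℕ∞} (hf : ContDiffAt ℝ n f u)
    (hmn : m + 1 ≤ n) (i : Fin 2) : ContDiffAt ℝ m (pderiv i f) u :=
  (hf.fderiv_right hmn).clm_apply contDiffAt_const

theorem pderiv_comm {f : E2 → F} {u : E2} (hf : ContDiffAt ℝ 2 f u) (i j : Fin 2) :
    pderiv i (pderiv j f) u = pderiv j (pderiv i f) u := by
  have hd : DifferentiableAt ℝ (fderiv ℝ f) u :=
    (hf.fderiv_right (m := 1) (by norm_num)).differentiableAt (by norm_num)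
  have key : ∀ a b : Fin 2, pderiv a (pderiv b f) u
      = fderiv ℝ (fderiv ℝ f) u (EuclideanSpace.single a 1) (EuclideanSpace.single b 1) := by
    intro a b
    have : pderiv b f = fun v => fderiv ℝ f v (EuclideanSpace.single b 1) := rfl
    rw [pderiv, this, fderiv_clm_apply hd (differentiableAt_const _)]
    simp
  rw [key, key]
  exact (hf.isSymmSndFDerivAt (by simp)).eq _ _

theorem fderiv_eq_sum_pderiv (f : E2 → F) (u v : E2) :
    fderiv ℝ f u v = v 0 • pderiv 0 f u + v 1 • pderiv 1 f u := by
  have hv : v = v 0 • EuclideanSpace.single (0 : Fin 2) (1 : ℝ)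
      + v 1 • EuclideanSpace.single (1 : Fin 2) (1 : ℝ) := by
    ext i; fin_cases i <;> simp
  conv_lhs => rw [hv]
  simp only [map_add, map_smul, pderiv]

theorem pderiv_comp {f : E2 → F} {τ : E2 → E2} {u : E2} (hf : DifferentiableAt ℝ f (τ u))
    (hτ : DifferentiableAt ℝ τ u) (i : Fin 2) :
    pderiv i (fun v => f (τ v)) u
      = pderiv i (fun v => τ v 0) u • pderiv 0 f (τ u)
        + pderiv i (fun v => τ v 1) u • pderiv 1 f (τ u) := by
  have h1 : ∀ a, pderiv i (fun v => τ v a) u = (pderiv i τ u) a := by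
    intro a
    have h := ((EuclideanSpace.proj a : E2 →L[ℝ] ℝ).hasFDerivAt.comp u hτ.hasFDerivAt).fderiv
    simp only [pderiv]
    have h' : fderiv ℝ (fun v => τ v a) u = (EuclideanSpace.proj a : E2 →L[ℝ] ℝ).comp
      (fderiv ℝ τ u) := h
    rw [h']; rfl
  rw [h1, h1, ← fderiv_eq_sum_pderiv]
  have h2 := (hf.hasFDerivAt.comp u hτ.hasFDerivAt).fderiv
  have h2' : fderiv ℝ (fun v => f (τ v)) u = _ := h2
  rw [pderiv, h2']; rfl

theorem contDiffAt_coord {τ : E2 → E2} {u : E2} {n : WithTop ℕ∞} (hτ : ContDiffAt ℝ n τ u)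
    (a : Fin 2) : ContDiffAt ℝ n (fun v => τ v a) u :=
  (contDiffAt_piLp_apply (𝕜 := ℝ) (p := 2)).comp u hτ

theorem pderiv_coord (i a : Fin 2) (u : E2) :
    pderiv i (fun v : E2 => v a) u = if a = i then 1 else 0 := by
  have h : fderiv ℝ (fun v : E2 => v a) u = (EuclideanSpace.proj a : E2 →L[ℝ] ℝ) :=
    (EuclideanSpace.proj a : E2 →L[ℝ] ℝ).fderiv
  simp [pderiv, h]

end Calculus

/-! ### Levi-Civita calculus of a plane metric and its behaviour under conformal change -/

section Metric

/-- The gradient of `f` with respect to the metric `G`. -/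
def metricGrad (G : E2 → Matrix (Fin 2) (Fin 2) ℝ) (f : E2 → ℝ) (k : Fin 2) (u : E2) : ℝ :=
  ∑ l, (G u)⁻¹ k l * pderiv l f u

/-- The Hessian of `f` with respect to the Levi-Civita connection of `G`. -/
def metricHess (G : E2 → Matrix (Fin 2) (Fin 2) ℝ) (f : E2 → ℝ) (i j : Fin 2) (u : E2) : ℝ :=
  pderiv i (pderiv j f) u - ∑ k, christoffel G k i j u * pderiv k f u

/-- The Laplace-Beltrami operator of `G`. -/
def metricLaplacian (G : E2 → Matrix (Fin 2) (Fin 2) ℝ) (f : E2 → ℝ) (u : E2) : ℝ :=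
  ∑ i, ∑ j, (G u)⁻¹ i j * metricHess G f i j u

/-- The Christoffel symbols of the first kind. -/
def christoffelLower (G : E2 → Matrix (Fin 2) (Fin 2) ℝ) (l i j : Fin 2) (u : E2) : ℝ :=
  (1 / 2 : ℝ) * (pderiv i (fun v => G v j l) u + pderiv j (fun v => G v i l) u
      - pderiv l (fun v => G v i j) u)

variable {G : E2 → Matrix (Fin 2) (Fin 2) ℝ} {u : E2}

theorem christoffel_eq_sum (k i j : Fin 2) :
    christoffel G k i j u = ∑ l, (G u)⁻¹ k l * christoffelLower G l i j u := by
  simp only [christoffel, christoffelLower, Finset.mul_sum]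
  exact Finset.sum_congr rfl fun l _ => by ring

theorem sum_mul_inv_mul (hdet : (G u).det ≠ 0) (a : Fin 2 → ℝ) (l : Fin 2) :
    ∑ k, G u l k * ∑ m, (G u)⁻¹ k m * a m = a l := by
  have h := congrFun (congrArg (fun A => A.mulVec a)
    (Matrix.mul_nonsing_inv (G u) (isUnit_iff_ne_zero.mpr hdet))) l
  simp only [Matrix.one_mulVec] at h
  rw [← h, ← Matrix.mulVec_mulVec]
  rfl

theorem sum_mul_christoffel (hdet : (G u).det ≠ 0) (l i j : Fin 2) :
    ∑ k, G u l k * christoffel G k i j u = christoffelLower G l i j u := by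
  simp only [christoffel_eq_sum]
  exact sum_mul_inv_mul hdet _ l

theorem sum_mul_metricGrad (hdet : (G u).det ≠ 0) (f : E2 → ℝ) (l : Fin 2) :
    ∑ k, G u l k * metricGrad G f k u = pderiv l f u :=
  sum_mul_inv_mul hdet _ l

theorem pderiv_symm (hsym : ∀ᶠ v in 𝓝 u, (G v).IsSymm) (m i j : Fin 2) :
    pderiv m (fun v => G v i j) u = pderiv m (fun v => G v j i) u :=
  pderiv_congr (hsym.mono fun _ hv => hv.apply j i) m

/-- Compatibility of the Levi-Civita connection with the metric. It trades derivatives of `G` for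
Christoffel symbols, which turns the conformal formula into a polynomial identity. -/
theorem pderiv_metric (hsym : ∀ᶠ v in 𝓝 u, (G v).IsSymm) (hdet : (G u).det ≠ 0) (m i j : Fin 2) :
    pderiv m (fun v => G v i j) u
      = ∑ a, (G u i a * christoffel G a j m u + G u j a * christoffel G a i m u) := by
  rw [Finset.sum_add_distrib, sum_mul_christoffel hdet, sum_mul_christoffel hdet]
  simp only [christoffelLower]
  rw [pderiv_symm hsym j m i, pderiv_symm hsym i m j, pderiv_symm hsym m j i]
  ring

theorem christoffel_symm (hsym : ∀ᶠ v in 𝓝 u, (G v).IsSymm) (k i j : Fin 2) :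
    christoffel G k i j u = christoffel G k j i u := by
  simp only [christoffel, pderiv_symm hsym _ i j]
  congr 1
  exact Finset.sum_congr rfl fun l _ => by ring

/-- The factor is `exp f` rather than `exp (2 f)`, hence the `1 / 2`: differentiating it yields `df
⊗ G`, and the exponential cancels against the one in the inverse metric. -/
theorem christoffel_conformal {f : E2 → ℝ} (hG : ∀ i j, DifferentiableAt ℝ (fun v => G v i j) u)
    (hsym : (G u).IsSymm) (hdet : (G u).det ≠ 0) (hf : DifferentiableAt ℝ f u) (k i j : Fin 2) :
    christoffel (fun v => Real.exp (f v) • G v) k i j u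
      = christoffel G k i j u + (1 / 2 : ℝ) * ((if k = j then pderiv i f u else 0)
          + (if k = i then pderiv j f u else 0) - G u i j * metricGrad G f k u) := by
  have hinv : (Real.exp (f u) • G u)⁻¹ = Real.exp (-f u) • (G u)⁻¹ := by
    apply Matrix.inv_eq_left_inv
    rw [Matrix.smul_mul, Matrix.mul_smul, Matrix.nonsing_inv_mul _ (isUnit_iff_ne_zero.mpr hdet),
      smul_smul, ← Real.exp_add]
    simp
  have hd : ∀ m a b, pderiv m (fun v => Real.exp (f v) * G v a b) u
      = Real.exp (f u) * (pderiv m f u * G u a b + pderiv m (fun v => G v a b) u) := by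
    intro m a b
    rw [pderiv_mul hf.exp (hG a b), pderiv_exp hf]
    ring
  have hone : ∀ a, (G u)⁻¹ k 0 * G u a 0 + (G u)⁻¹ k 1 * G u a 1 = if k = a then 1 else 0 := by
    intro a
    have h := congrFun (congrFun
      (Matrix.nonsing_inv_mul (G u) (isUnit_iff_ne_zero.mpr hdet)) k) a
    rw [Matrix.mul_apply, Fin.sum_univ_two, Matrix.one_apply] at h
    rw [hsym.apply 0 a, hsym.apply 1 a, h]
  have he : Real.exp (-f u) * Real.exp (f u) = 1 := by rw [← Real.exp_add]; simp
  have hi : ∀ a b, (if k = a then pderiv b f u else 0) = (if k = a then 1 else 0) * pderiv b f u := by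
    intro a b; split_ifs <;> simp
  simp only [christoffel, hinv, metricGrad, hi, ← hone, Fin.sum_univ_two, Matrix.smul_apply,
    smul_eq_mul, hd]
  generalize Real.exp (-f u) = e at *
  generalize Real.exp (f u) = E at *
  generalize (G u)⁻¹ = H
  linear_combination (1 / 2 : ℝ) *
    (H k 0 * (pderiv i f u * G u j 0 + pderiv i (fun v => G v j 0) u
        + (pderiv j f u * G u i 0 + pderiv j (fun v => G v i 0) u)
        - (pderiv 0 f u * G u i j + pderiv 0 (fun v => G v i j) u))
      + H k 1 * (pderiv i f u * G u j 1 + pderiv i (fun v => G v j 1) u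
        + (pderiv j f u * G u i 1 + pderiv j (fun v => G v i 1) u)
        - (pderiv 1 f u * G u i j + pderiv 1 (fun v => G v i j) u))) * he

theorem contDiffAt_det {n : WithTop ℕ∞} (hG : ∀ i j, ContDiffAt ℝ n (fun v => G v i j) u) :
    ContDiffAt ℝ n (fun v => (G v).det) u := by
  simp only [Matrix.det_fin_two]
  exact ((hG 0 0).mul (hG 1 1)).sub ((hG 0 1).mul (hG 1 0))

theorem inv_fin_two (A : Matrix (Fin 2) (Fin 2) ℝ) :
    A⁻¹ = (A.det)⁻¹ • !![A 1 1, -A 0 1; -A 1 0, A 0 0] := by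
  rw [Matrix.inv_def, Matrix.adjugate_fin_two, Ring.inverse_eq_inv']

theorem contDiffAt_inv {n : WithTop ℕ∞} (hG : ∀ i j, ContDiffAt ℝ n (fun v => G v i j) u)
    (hdet : (G u).det ≠ 0) (i j : Fin 2) : ContDiffAt ℝ n (fun v => (G v)⁻¹ i j) u := by
  have h := (contDiffAt_det hG).inv hdet
  simp only [inv_fin_two]
  fin_cases i <;> fin_cases j <;> simp
  · exact h.mul (hG 1 1)
  · exact (h.mul (hG 0 1)).neg
  · exact (h.mul (hG 1 0)).neg
  · exact h.mul (hG 0 0)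

theorem contDiffAt_christoffel {n m : WithTop ℕ∞} (hG : ∀ i j, ContDiffAt ℝ n (fun v => G v i j) u)
    (hmn : m + 1 ≤ n) (hdet : (G u).det ≠ 0) (k i j : Fin 2) :
    ContDiffAt ℝ m (christoffel G k i j) u := by
  have hd : ∀ l a b, ContDiffAt ℝ m (pderiv l (fun v => G v a b)) u :=
    fun l a b => contDiffAt_pderiv (hG a b) hmn l
  have hi : ∀ a b, ContDiffAt ℝ m (fun v => (G v)⁻¹ a b) u := fun a b =>
    (contDiffAt_inv hG hdet a b).of_le (le_self_add.trans hmn)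
  unfold christoffel
  exact contDiffAt_const.mul (ContDiffAt.sum fun l _ =>
    (hi k l).mul (((hd i j l).add (hd j i l)).sub (hd l i j)))

theorem contDiffAt_metricGrad {f : E2 → ℝ} {n m : WithTop ℕ∞}
    (hG : ∀ i j, ContDiffAt ℝ m (fun v => G v i j) u) (hf : ContDiffAt ℝ n f u)
    (hmn : m + 1 ≤ n) (hdet : (G u).det ≠ 0) (k : Fin 2) :
    ContDiffAt ℝ m (metricGrad G f k) u :=
  ContDiffAt.sum fun l _ => (contDiffAt_inv hG hdet k l).mul (contDiffAt_pderiv hf hmn l)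

theorem pderiv_christoffel_conformal {f : E2 → ℝ} (hG : ∀ i j, ContDiffAt ℝ 2 (fun v => G v i j) u)
    (hsym : ∀ᶠ v in 𝓝 u, (G v).IsSymm) (hdet : (G u).det ≠ 0) (hf : ContDiffAt ℝ 2 f u)
    (m k i j : Fin 2) :
    pderiv m (christoffel (fun v => Real.exp (f v) • G v) k i j) u
      = pderiv m (christoffel G k i j) u
        + (1 / 2 : ℝ) * ((if k = j then pderiv m (pderiv i f) u else 0)
          + (if k = i then pderiv m (pderiv j f) u else 0)
          - (pderiv m (fun v => G v i j) u * metricGrad G f k u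
            + G u i j * pderiv m (metricGrad G f k) u)) := by
  have hG' : ∀ᶠ v in 𝓝 u, ∀ i j, DifferentiableAt ℝ (fun v => G v i j) v := by
    simp only [Filter.eventually_all]
    exact fun i j => ((hG i j).eventually (by simp)).mono fun v hv =>
      hv.differentiableAt (by simp)
  have hdet' : ∀ᶠ v in 𝓝 u, (G v).det ≠ 0 :=
    (contDiffAt_det hG).continuousAt.eventually_ne hdet
  have hf' : ∀ᶠ v in 𝓝 u, DifferentiableAt ℝ f v :=
    (hf.eventually (by simp)).mono fun v hv => hv.differentiableAt (by simp)
  have hev : christoffel (fun v => Real.exp (f v) • G v) k i j =ᶠ[𝓝 u] fun v =>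
      christoffel G k i j v + (1 / 2 : ℝ) * ((if k = j then pderiv i f v else 0)
          + (if k = i then pderiv j f v else 0) - G v i j * metricGrad G f k v) := by
    filter_upwards [hG', hdet', hf', hsym] with v h1 h2 h3 h4
    exact christoffel_conformal h1 h4 h2 h3 k i j
  have d1 : DifferentiableAt ℝ (christoffel G k i j) u :=
    (contDiffAt_christoffel (m := 1) hG (by norm_num) hdet k i j).differentiableAt (by simp)
  have d2 : ∀ a, DifferentiableAt ℝ (pderiv a f) u := fun a =>
    (contDiffAt_pderiv (m := 1) hf (by norm_num) a).differentiableAt (by simp)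
  have d3 : DifferentiableAt ℝ (metricGrad G f k) u :=
    (contDiffAt_metricGrad (m := 1) (fun i j => (hG i j).of_le (by norm_num)) hf (by norm_num)
      hdet k).differentiableAt (by simp)
  have d4 : DifferentiableAt ℝ (fun v => G v i j) u := (hG i j).differentiableAt (by simp)
  have d5 : ∀ (p : Prop) [Decidable p] (a : Fin 2),
      DifferentiableAt ℝ (fun v => if p then pderiv a f v else 0) u := by
    intro p _ a
    split_ifs
    exacts [d2 a, differentiableAt_const _]
  have d6 : ∀ (p : Prop) [Decidable p] (a : Fin 2),
      pderiv m (fun v => if p then pderiv a f v else 0) u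
        = if p then pderiv m (pderiv a f) u else 0 := by
    intro p _ a
    split_ifs
    exacts [rfl, pderiv_const _ _ _]
  have d7 := (d5 (k = j) i).fun_add (d5 (k = i) j)
  have d8 := d4.fun_mul d3
  rw [pderiv_congr hev, pderiv_add d1 (DifferentiableAt.const_mul (d7.fun_sub d8) _),
    pderiv_const_mul _ (d7.fun_sub d8), pderiv_sub d7 d8, pderiv_add (d5 _ _) (d5 _ _),
    pderiv_mul d4 d3, d6, d6]

/-- Differentiates `∂_j f = G_{jk} V^k` with `V` the gradient, so that only `V` and its first
derivatives remain in the conformal formula. -/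
theorem pderiv_pderiv_eq_sum_metricGrad {f : E2 → ℝ}
    (hG : ∀ i j, ContDiffAt ℝ 2 (fun v => G v i j) u)
    (hdet : (G u).det ≠ 0) (hf : ContDiffAt ℝ 2 f u) (i j : Fin 2) :
    pderiv i (pderiv j f) u = ∑ k, (pderiv i (fun v => G v j k) u * metricGrad G f k u
      + G u j k * pderiv i (metricGrad G f k) u) := by
  have hdet' : ∀ᶠ v in 𝓝 u, (G v).det ≠ 0 :=
    (contDiffAt_det hG).continuousAt.eventually_ne hdet
  have hev : pderiv j f =ᶠ[𝓝 u] fun v => G v j 0 * metricGrad G f 0 v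
      + G v j 1 * metricGrad G f 1 v := by
    filter_upwards [hdet'] with v hv
    rw [← sum_mul_metricGrad hv f j, Fin.sum_univ_two]
  have d3 : ∀ k, DifferentiableAt ℝ (metricGrad G f k) u := fun k =>
    (contDiffAt_metricGrad (m := 1) (fun i j => (hG i j).of_le (by norm_num)) hf (by norm_num)
      hdet k).differentiableAt (by simp)
  have d4 : ∀ k, DifferentiableAt ℝ (fun v => G v j k) u :=
    fun k => (hG j k).differentiableAt (by simp)
  rw [pderiv_congr hev, pderiv_add ((d4 0).fun_mul (d3 0)) ((d4 1).fun_mul (d3 1)),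
    pderiv_mul (d4 0) (d3 0), pderiv_mul (d4 1) (d3 1), Fin.sum_univ_two]

set_option maxHeartbeats 1600000 in
/-- The change of the curvature of a two-dimensional metric under a conformal change. -/
theorem metricCurvature_conformal {f : E2 → ℝ} (hG : ∀ i j, ContDiffAt ℝ 2 (fun v => G v i j) u)
    (hsym : ∀ᶠ v in 𝓝 u, (G v).IsSymm) (hdet : (G u).det ≠ 0) (hf : ContDiffAt ℝ 2 f u) :
    metricCurvature (fun v => Real.exp (f v) • G v) u
      = Real.exp (-f u) * (metricCurvature G u - (1 / 2 : ℝ) * metricLaplacian G f u) := by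
  have hinv : (Real.exp (f u) • G u)⁻¹ = Real.exp (-f u) • (G u)⁻¹ := by
    apply Matrix.inv_eq_left_inv
    rw [Matrix.smul_mul, Matrix.mul_smul, Matrix.nonsing_inv_mul _ (isUnit_iff_ne_zero.mpr hdet),
      smul_smul, ← Real.exp_add]
    simp
  have hG' : ∀ i j, DifferentiableAt ℝ (fun v => G v i j) u := fun i j =>
    (hG i j).differentiableAt (by simp)
  have hf' : DifferentiableAt ℝ f u := hf.differentiableAt (by simp)
  have hs := hsym.self_of_nhds
  have key : ∑ j, ∑ k, (G u)⁻¹ j k * ricci (fun v => Real.exp (f v) • G v) k j u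
      = ∑ j, ∑ k, (G u)⁻¹ j k * ricci G k j u - metricLaplacian G f u := by
    simp only [metricLaplacian, metricHess, ricci, riemann, pderiv_christoffel_conformal hG hsym hdet hf,
      christoffel_conformal hG' hs hdet hf', pderiv_pderiv_eq_sum_metricGrad hG hdet hf,
      pderiv_metric hsym hdet, ← sum_mul_metricGrad hdet f]
    have hs' : G u 1 0 = G u 0 1 := hs.apply 0 1
    simp only [Fin.sum_univ_two, christoffel_symm hsym _ 1 0, hs', inv_fin_two, Matrix.smul_apply,
      Matrix.of_apply, Matrix.cons_val', Matrix.cons_val_zero, Matrix.cons_val_one, smul_eq_mul,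
      if_true, if_false, zero_ne_one, one_ne_zero, Matrix.cons_val_fin_one]
    -- Every remaining term is linear in the inverse determinant, so the relation between it and the
    -- entries of `G` is not needed. The terms quadratic in the gradient cancel because the
    -- dimension is two.
    generalize (G u).det⁻¹ = D
    generalize pderiv 0 (metricGrad G f 0) u = dV00
    generalize pderiv 0 (metricGrad G f 1) u = dV01
    generalize pderiv 1 (metricGrad G f 0) u = dV10
    generalize pderiv 1 (metricGrad G f 1) u = dV11
    generalize metricGrad G f 0 u = V0
    generalize metricGrad G f 1 u = V1
    generalize christoffel G 0 0 0 u = C000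
    generalize christoffel G 0 0 1 u = C001
    generalize christoffel G 0 1 1 u = C011
    generalize christoffel G 1 0 0 u = C100
    generalize christoffel G 1 0 1 u = C101
    generalize christoffel G 1 1 1 u = C111
    generalize G u 0 0 = g00
    generalize G u 0 1 = g01
    generalize G u 1 1 = g11
    ring
  simp only [metricCurvature, hinv, Matrix.smul_apply, smul_eq_mul, mul_assoc]
  simp only [← Finset.mul_sum]
  rw [key]
  ring

end Metric

/-! ### Coordinate invariance of the Laplacian -/

section CoordinateChange

/-- The Jacobian matrix of a map of the coordinate plane. -/
def jacobian (τ : E2 → E2) (u : E2) : Matrix (Fin 2) (Fin 2) ℝ :=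
  Matrix.of fun a i => pderiv i (fun v => τ v a) u

theorem pderiv_comp_eq {f : E2 → ℝ} {τ : E2 → E2} {u : E2} (hf : DifferentiableAt ℝ f (τ u))
    (hτ : DifferentiableAt ℝ τ u) (i : Fin 2) :
    pderiv i (fun v => f (τ v)) u
      = jacobian τ u 0 i * pderiv 0 f (τ u) + jacobian τ u 1 i * pderiv 1 f (τ u) :=
  pderiv_comp hf hτ i

theorem pderiv_jacobian_comm {τ : E2 → E2} {u : E2} (hτ : ContDiffAt ℝ 2 τ u) (a i j : Fin 2) :
    pderiv i (fun v => jacobian τ v a j) u = pderiv j (fun v => jacobian τ v a i) u :=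
  pderiv_comm (contDiffAt_coord hτ a) i j

variable {G G' : E2 → Matrix (Fin 2) (Fin 2) ℝ} {τ : E2 → E2} {u : E2}

theorem contDiffAt_jacobian {m n : WithTop ℕ∞} (hτ : ContDiffAt ℝ n τ u) (hmn : m + 1 ≤ n)
    (a i : Fin 2) : ContDiffAt ℝ m (fun v => jacobian τ v a i) u :=
  contDiffAt_pderiv (contDiffAt_coord hτ a) hmn i

theorem congruence_apply (J A : Matrix (Fin 2) (Fin 2) ℝ) (i j : Fin 2) :
    (J.transpose * A * J) i j = J 0 i * (J 0 j * A 0 0) + J 0 i * (J 1 j * A 0 1)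
      + (J 1 i * (J 0 j * A 1 0) + J 1 i * (J 1 j * A 1 1)) := by
  simp only [Matrix.mul_apply, Fin.sum_univ_two, Matrix.transpose_apply]
  ring

theorem pderiv_congruence (hτ : ContDiffAt ℝ 2 τ u)
    (hG' : ∀ i j, DifferentiableAt ℝ (fun v => G' v i j) (τ u))
    (hG : G =ᶠ[𝓝 u] fun v => (jacobian τ v).transpose * G' (τ v) * jacobian τ v)
    (m i j : Fin 2) :
    pderiv m (fun v => G v i j) u = ∑ a, ∑ b,
      (pderiv m (fun v => jacobian τ v a i) u * (jacobian τ u b j * G' (τ u) a b)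
        + jacobian τ u a i * (pderiv m (fun v => jacobian τ v b j) u * G' (τ u) a b
          + jacobian τ u b j * (jacobian τ u 0 m * pderiv 0 (fun v => G' v a b) (τ u)
            + jacobian τ u 1 m * pderiv 1 (fun v => G' v a b) (τ u)))) := by
  have hev : (fun v => G v i j) =ᶠ[𝓝 u] fun v =>
      jacobian τ v 0 i * (jacobian τ v 0 j * G' (τ v) 0 0)
      + jacobian τ v 0 i * (jacobian τ v 1 j * G' (τ v) 0 1)
      + (jacobian τ v 1 i * (jacobian τ v 0 j * G' (τ v) 1 0)
        + jacobian τ v 1 i * (jacobian τ v 1 j * G' (τ v) 1 1)) := by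
    filter_upwards [hG] with v hv
    rw [hv, congruence_apply]
  have hτ' : DifferentiableAt ℝ τ u := hτ.differentiableAt (by simp)
  have d1 : ∀ a i, DifferentiableAt ℝ (fun v => jacobian τ v a i) u := fun a i =>
    (contDiffAt_jacobian (m := 1) hτ (by norm_num) a i).differentiableAt (by simp)
  have d2 : ∀ a b, DifferentiableAt ℝ (fun v => G' (τ v) a b) u := fun a b =>
    (hG' a b).comp u hτ'
  have d3 : ∀ a b, DifferentiableAt ℝ (fun v => jacobian τ v b j * G' (τ v) a b) u :=
    fun a b => (d1 b j).fun_mul (d2 a b)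
  have d4 : ∀ a b, DifferentiableAt ℝ
      (fun v => jacobian τ v a i * (jacobian τ v b j * G' (τ v) a b)) u :=
    fun a b => (d1 a i).fun_mul (d3 a b)
  have d5 : ∀ a b, pderiv m (fun v => G' (τ v) a b) u = _ := fun a b =>
    pderiv_comp_eq (hG' a b) hτ' m
  rw [pderiv_congr hev, pderiv_add ((d4 _ _).fun_add (d4 _ _)) ((d4 _ _).fun_add (d4 _ _)),
    pderiv_add (d4 _ _) (d4 _ _), pderiv_add (d4 _ _) (d4 _ _)]
  simp only [pderiv_mul (d1 _ _) (d3 _ _), pderiv_mul (d1 _ _) (d2 _ _), d5, Fin.sum_univ_two]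

/-- The symbols of the first kind transform without inverting the Jacobian. The inhomogeneous term
with second derivatives of `τ` comes out right because these derivatives are symmetric. -/
theorem christoffelLower_congruence (hτ : ContDiffAt ℝ 2 τ u)
    (hG' : ∀ i j, DifferentiableAt ℝ (fun v => G' v i j) (τ u))
    (hsym : ∀ᶠ v in 𝓝 (τ u), (G' v).IsSymm)
    (hG : G =ᶠ[𝓝 u] fun v => (jacobian τ v).transpose * G' (τ v) * jacobian τ v)
    (l i j : Fin 2) :
    christoffelLower G l i j u = ∑ a, jacobian τ u a l *
      ((∑ b, ∑ c, jacobian τ u b i * jacobian τ u c j * christoffelLower G' a b c (τ u))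
        + ∑ b, G' (τ u) a b * pderiv i (fun v => jacobian τ v b j) u) := by
  have hs : G' (τ u) 1 0 = G' (τ u) 0 1 := hsym.self_of_nhds.apply 0 1
  have hs' : ∀ m, pderiv m (fun v => G' v 1 0) (τ u) = pderiv m (fun v => G' v 0 1) (τ u) :=
    fun m => pderiv_symm hsym m 1 0
  simp only [christoffelLower, pderiv_congruence hτ hG' hG, Fin.sum_univ_two, hs, hs']
  rw [pderiv_jacobian_comm hτ 0 j i, pderiv_jacobian_comm hτ 1 j i,
    pderiv_jacobian_comm hτ 0 l i, pderiv_jacobian_comm hτ 1 l i,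
    pderiv_jacobian_comm hτ 0 l j, pderiv_jacobian_comm hτ 1 l j]
  ring

/-- Moves the inverse metric from the connection to the gradient, so that the Hessian involves only
symbols of the first kind. -/
theorem sum_christoffel_mul (hsym : (G u).IsSymm) (f : E2 → ℝ) (i j : Fin 2) :
    ∑ k, christoffel G k i j u * pderiv k f u
      = ∑ l, christoffelLower G l i j u * metricGrad G f l u := by
  have h : (G u)⁻¹ 1 0 = (G u)⁻¹ 0 1 := hsym.inv.apply 0 1
  simp only [christoffel_eq_sum, metricGrad, Fin.sum_univ_two, h]
  ring

/-- The Hessian is a tensor: the second derivatives of `τ` produced by the chain rule cancel against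
the inhomogeneous term of the Christoffel symbols. -/
theorem metricHess_comp {f : E2 → ℝ} (hτ : ContDiffAt ℝ 2 τ u)
    (hG' : ∀ i j, DifferentiableAt ℝ (fun v => G' v i j) (τ u))
    (hsym : ∀ᶠ v in 𝓝 (τ u), (G' v).IsSymm)
    (hG : G =ᶠ[𝓝 u] fun v => (jacobian τ v).transpose * G' (τ v) * jacobian τ v)
    (hdet : (G u).det ≠ 0) (hf : ContDiffAt ℝ 2 f (τ u)) (i j : Fin 2) :
    metricHess G (fun v => f (τ v)) i j u
      = ((jacobian τ u).transpose * (Matrix.of fun a b => metricHess G' f a b (τ u))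
          * jacobian τ u) i j := by
  have hs := hsym.self_of_nhds
  have hGu : G u = (jacobian τ u).transpose * G' (τ u) * jacobian τ u := hG.self_of_nhds
  have hGs : (G u).IsSymm := by
    rw [hGu, Matrix.IsSymm, Matrix.transpose_mul, Matrix.transpose_mul, Matrix.transpose_transpose,
      hs.eq, Matrix.mul_assoc]
  have hdets : (jacobian τ u).det ≠ 0 ∧ (G' (τ u)).det ≠ 0 := by
    rw [hGu, Matrix.det_mul, Matrix.det_mul, Matrix.det_transpose] at hdet
    refine ⟨fun h => hdet (by simp [h]), fun h => hdet (by simp [h])⟩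
  have hτ' : DifferentiableAt ℝ τ u := hτ.differentiableAt (by simp)
  have hf' : DifferentiableAt ℝ f (τ u) := hf.differentiableAt (by simp)
  have hfev : ∀ᶠ v in 𝓝 u, DifferentiableAt ℝ f (τ v) :=
    hτ.continuousAt.eventually ((hf.eventually (by simp)).mono
      fun v hv => hv.differentiableAt (by simp))
  have hτev : ∀ᶠ v in 𝓝 u, DifferentiableAt ℝ τ v :=
    (hτ.eventually (by simp)).mono fun v hv => hv.differentiableAt (by simp)
  have hp : ∀ k, pderiv k (fun v => f (τ v)) =ᶠ[𝓝 u] fun v =>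
      jacobian τ v 0 k * pderiv 0 f (τ v) + jacobian τ v 1 k * pderiv 1 f (τ v) := by
    intro k
    filter_upwards [hfev, hτev] with v h1 h2
    exact pderiv_comp_eq h1 h2 k
  have dp : ∀ a, DifferentiableAt ℝ (pderiv a f) (τ u) := fun a =>
    (contDiffAt_pderiv (m := 1) hf (by norm_num) a).differentiableAt (by simp)
  have dp' : ∀ a, DifferentiableAt ℝ (fun v => pderiv a f (τ v)) u := fun a => (dp a).comp u hτ'
  have d1 : ∀ a i, DifferentiableAt ℝ (fun v => jacobian τ v a i) u := fun a i =>
    (contDiffAt_jacobian (m := 1) hτ (by norm_num) a i).differentiableAt (by simp)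
  -- The gradient is contravariant: the Jacobian pushes it forward.
  have hV : ∀ a, jacobian τ u a 0 * metricGrad G (fun v => f (τ v)) 0 u
      + jacobian τ u a 1 * metricGrad G (fun v => f (τ v)) 1 u = metricGrad G' f a (τ u) := by
    intro a
    have h1 : (G u)⁻¹ = (jacobian τ u)⁻¹ * (G' (τ u))⁻¹ * ((jacobian τ u)⁻¹).transpose := by
      rw [hGu, Matrix.mul_inv_rev, Matrix.mul_inv_rev, Matrix.transpose_nonsing_inv,
        Matrix.mul_assoc]
    have h2 : (fun k => metricGrad G (fun v => f (τ v)) k u)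
        = (G u)⁻¹.mulVec ((jacobian τ u).transpose.mulVec fun a => pderiv a f (τ u)) := by
      funext k
      simp only [metricGrad, (hp _).self_of_nhds, Matrix.mulVec, dotProduct, Fin.sum_univ_two,
        Matrix.transpose_apply]
    have h3 : (jacobian τ u).mulVec (fun k => metricGrad G (fun v => f (τ v)) k u)
        = fun a => metricGrad G' f a (τ u) := by
      rw [h2, h1, Matrix.mulVec_mulVec, Matrix.mulVec_mulVec]
      have h4 : jacobian τ u * ((jacobian τ u)⁻¹ * (G' (τ u))⁻¹ * (jacobian τ u)⁻¹.transpose)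
          * (jacobian τ u).transpose = (G' (τ u))⁻¹ := by
        rw [Matrix.transpose_nonsing_inv, Matrix.mul_assoc, Matrix.mul_assoc, Matrix.mul_assoc,
          Matrix.nonsing_inv_mul _ (by rw [Matrix.det_transpose]; exact hdets.1.isUnit),
          Matrix.mul_one, ← Matrix.mul_assoc, Matrix.mul_nonsing_inv _ hdets.1.isUnit,
          Matrix.one_mul]
      rw [← Matrix.mul_assoc] at h4 ⊢
      rw [h4]
      rfl
    have h5 := congrFun h3 a
    simpa only [Matrix.mulVec, dotProduct, Fin.sum_univ_two] using h5
  have hpp : pderiv i (pderiv j fun v => f (τ v)) u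
      = pderiv i (fun v => jacobian τ v 0 j) u * pderiv 0 f (τ u)
        + jacobian τ u 0 j * (jacobian τ u 0 i * pderiv 0 (pderiv 0 f) (τ u)
          + jacobian τ u 1 i * pderiv 1 (pderiv 0 f) (τ u))
        + (pderiv i (fun v => jacobian τ v 1 j) u * pderiv 1 f (τ u)
        + jacobian τ u 1 j * (jacobian τ u 0 i * pderiv 0 (pderiv 1 f) (τ u)
          + jacobian τ u 1 i * pderiv 1 (pderiv 1 f) (τ u))) := by
    rw [pderiv_congr (hp j), pderiv_add ((d1 _ _).fun_mul (dp' _)) ((d1 _ _).fun_mul (dp' _)),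
      pderiv_mul (d1 _ _) (dp' _), pderiv_mul (d1 _ _) (dp' _), pderiv_comp_eq (dp 0) hτ',
      pderiv_comp_eq (dp 1) hτ']
  rw [congruence_apply]
  simp only [Matrix.of_apply, metricHess, sum_christoffel_mul hGs, sum_christoffel_mul hs]
  simp only [hpp, christoffelLower_congruence hτ hG' hsym hG, ← sum_mul_metricGrad hdets.2 f, ← hV,
    Fin.sum_univ_two, hs.apply 0 1]
  ring

theorem sum_inv_congruence {J A : Matrix (Fin 2) (Fin 2) ℝ} (hJ : J.det ≠ 0)
    (B : Matrix (Fin 2) (Fin 2) ℝ) :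
    ∑ i, ∑ j, (J.transpose * A * J)⁻¹ i j * (J.transpose * B * J) i j
      = ∑ i, ∑ j, A⁻¹ i j * B i j := by
  have h : ∀ P Q : Matrix (Fin 2) (Fin 2) ℝ,
      ∑ i, ∑ j, P i j * Q i j = (P * Q.transpose).trace := by
    intro P Q
    simp [Matrix.trace, Matrix.mul_apply]
  rw [h, h, Matrix.mul_inv_rev, Matrix.mul_inv_rev, Matrix.transpose_mul, Matrix.transpose_mul,
    Matrix.transpose_transpose, Matrix.mul_assoc, Matrix.trace_mul_comm, Matrix.mul_assoc,
    Matrix.mul_assoc, ← Matrix.mul_assoc (J.transpose)⁻¹,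
    Matrix.nonsing_inv_mul_cancel_left _ _ (by rw [Matrix.det_transpose]; exact hJ.isUnit),
    Matrix.mul_nonsing_inv_cancel_right _ _ hJ.isUnit]

/-- The Laplace-Beltrami operator does not depend on the coordinates. -/
theorem metricLaplacian_comp {f : E2 → ℝ} (hτ : ContDiffAt ℝ 2 τ u)
    (hG' : ∀ i j, DifferentiableAt ℝ (fun v => G' v i j) (τ u))
    (hsym : ∀ᶠ v in 𝓝 (τ u), (G' v).IsSymm)
    (hG : G =ᶠ[𝓝 u] fun v => (jacobian τ v).transpose * G' (τ v) * jacobian τ v)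
    (hdet : (G u).det ≠ 0) (hf : ContDiffAt ℝ 2 f (τ u)) :
    metricLaplacian G (fun v => f (τ v)) u = metricLaplacian G' f (τ u) := by
  have hJ : (jacobian τ u).det ≠ 0 := by
    intro h
    rw [hG.self_of_nhds, Matrix.det_mul] at hdet
    exact hdet (by simp [h])
  simp only [metricLaplacian, metricHess_comp hτ hG' hsym hG hdet hf]
  rw [hG.self_of_nhds, sum_inv_congruence hJ]
  rfl

theorem metricLaplacian_congr {f g : E2 → ℝ} (h : f =ᶠ[𝓝 u] g) :
    metricLaplacian G f u = metricLaplacian G g u := by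
  simp only [metricLaplacian, metricHess, pderiv_congr h, pderiv_congr (pderiv_eventuallyEq h _)]

end CoordinateChange

/-! ### The strong maximum principle for second-order elliptic operators in the plane -/

section MaximumPrinciple

/-- Restriction to a line. -/
theorem hasDerivAt_line {f : E2 → ℝ} {u : E2} (a b : ℝ) (t : ℝ)
    (hf : DifferentiableAt ℝ f (u + t • !₂[a, b])) :
    HasDerivAt (fun s : ℝ => f (u + s • !₂[a, b]))
      (a * pderiv 0 f (u + t • !₂[a, b]) + b * pderiv 1 f (u + t • !₂[a, b])) t := by
  have h1 : HasDerivAt (fun s : ℝ => u + s • (!₂[a, b] : E2)) (!₂[a, b] : E2) t := by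
    simpa using ((hasDerivAt_id t).smul_const (!₂[a, b] : E2)).const_add u
  have h2 := hf.hasFDerivAt.comp_hasDerivAt t h1
  rw [fderiv_eq_sum_pderiv] at h2
  exact h2

/-- The Hessian is negative semidefinite at a local maximum. -/
theorem hessian_nonpos_of_isLocalMax {f : E2 → ℝ} {u : E2} (hf : ContDiffAt ℝ 2 f u)
    (hmax : IsLocalMax f u) (a b : ℝ) :
    a * (a * pderiv 0 (pderiv 0 f) u + b * pderiv 1 (pderiv 0 f) u)
      + b * (a * pderiv 0 (pderiv 1 f) u + b * pderiv 1 (pderiv 1 f) u) ≤ 0 := by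
  by_contra! hpos
  set l : ℝ → E2 := fun s => u + s • !₂[a, b] with hl
  have hl0 : l 0 = u := by simp [hl]
  have hlc : ContinuousAt l 0 := by
    have : Continuous l := by fun_prop
    exact this.continuousAt
  have hd : ∀ᶠ s in 𝓝 (0 : ℝ), HasDerivAt (fun s => f (l s))
      (a * pderiv 0 f (l s) + b * pderiv 1 f (l s)) s := by
    have : ∀ᶠ v in 𝓝 (l 0), DifferentiableAt ℝ f v := by
      rw [hl0]
      exact (hf.eventually (by simp)).mono fun v hv => hv.differentiableAt (by simp)
    filter_upwards [hlc.eventually this] with s hs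
    exact hasDerivAt_line a b s hs
  have dp : ∀ a, DifferentiableAt ℝ (pderiv a f) (l 0) := fun a => by
    rw [hl0]
    exact (contDiffAt_pderiv (m := 1) hf (by norm_num) a).differentiableAt (by simp)
  have hdd : HasDerivAt (fun s => a * pderiv 0 f (l s) + b * pderiv 1 f (l s))
      (a * (a * pderiv 0 (pderiv 0 f) u + b * pderiv 1 (pderiv 0 f) u)
      + b * (a * pderiv 0 (pderiv 1 f) u + b * pderiv 1 (pderiv 1 f) u)) 0 := by
    have := ((hasDerivAt_line a b 0 (dp 0)).const_mul a).fun_add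
      ((hasDerivAt_line a b 0 (dp 1)).const_mul b)
    simpa [hl] using this
  have hderiv : deriv (fun s => f (l s)) =ᶠ[𝓝 0]
      fun s => a * pderiv 0 f (l s) + b * pderiv 1 f (l s) := hd.mono fun s hs => hs.deriv
  have hlm : IsLocalMax (fun s => f (l s)) 0 := by
    have h : ∀ᶠ v in 𝓝 (l 0), f v ≤ f (l 0) := by rw [hl0]; exact hmax
    exact hlc.eventually h
  have hd0 : deriv (fun s => f (l s)) 0 = 0 := hlm.deriv_eq_zero
  -- A positive second derivative at a critical point would make the local maximum on the line a
  -- local minimum as well; the restriction would be locally constant and its second derivative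
  -- zero.
  have hmin : IsLocalMin (fun s => f (l s)) 0 := by
    apply isLocalMin_of_deriv_deriv_pos _ hd0 hd.self_of_nhds.continuousAt
    rw [hderiv.deriv_eq, hdd.deriv]
    exact hpos
  have hconst : (fun s => f (l s)) =ᶠ[𝓝 0] fun _ => f (l 0) := by
    filter_upwards [hlm, hmin] with s h1 h2
    exact le_antisymm h1 h2
  have h1 : deriv (fun s => f (l s)) =ᶠ[𝓝 0] fun _ => 0 := by
    have := hconst.deriv
    simpa using this
  have h2 : deriv (deriv (fun s => f (l s))) 0 = 0 := by
    rw [h1.deriv_eq]; simp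
  rw [hderiv.deriv_eq, hdd.deriv] at h2
  linarith

/-- The second-order operator with coefficients `A`, `B`. -/
def ellipticOp (A : E2 → Matrix (Fin 2) (Fin 2) ℝ) (B : Fin 2 → E2 → ℝ) (f : E2 → ℝ)
    (u : E2) : ℝ :=
  ∑ i, ∑ j, A u i j * pderiv i (pderiv j f) u + ∑ k, B k u * pderiv k f u

variable {A : E2 → Matrix (Fin 2) (Fin 2) ℝ} {B : Fin 2 → E2 → ℝ}

theorem ellipticOp_nonpos_of_isLocalMax {f : E2 → ℝ} {u : E2} (hA : (A u).PosDef)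
    (hf : ContDiffAt ℝ 2 f u) (hmax : IsLocalMax f u) : ellipticOp A B f u ≤ 0 := by
  have h0 : ∀ k, pderiv k f u = 0 := fun k => by simp [pderiv, hmax.fderiv_eq_zero]
  have hs : A u 1 0 = A u 0 1 := hA.isHermitian.apply 0 1
  have ha : 0 < A u 0 0 := hA.diag_pos
  have hd := hA.det_pos
  rw [Matrix.det_fin_two, hs] at hd
  -- Completing the square replaces diagonalization: `A₀₀ tr(A · Hess)` is the Hessian form on
  -- `(A₀₀, A₀₁)` plus `det A` times its value on `(0, 1)`.
  have h1 := hessian_nonpos_of_isLocalMax hf hmax (A u 0 0) (A u 0 1)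
  have h2 := hessian_nonpos_of_isLocalMax hf hmax 0 1
  have h3 := pderiv_comm hf 0 1
  simp only [ellipticOp, Fin.sum_univ_two, h0, hs]
  rw [h3] at h1 h2 ⊢
  have h4 : A u 0 0 * (A u 0 0 * pderiv 0 (pderiv 0 f) u + A u 0 1 * pderiv 1 (pderiv 0 f) u
      + (A u 0 1 * pderiv 1 (pderiv 0 f) u + A u 1 1 * pderiv 1 (pderiv 1 f) u)) ≤ 0 := by
    have h5 := mul_nonpos_of_nonneg_of_nonpos hd.le
      (by simpa using h2 : pderiv 1 (pderiv 1 f) u ≤ 0)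
    nlinarith
  have h6 := nonpos_of_mul_nonpos_right h4 ha
  simpa using h6

theorem ellipticOp_add {f g : E2 → ℝ} {u : E2} (c : ℝ) (hf : ContDiffAt ℝ 2 f u)
    (hg : ContDiffAt ℝ 2 g u) :
    ellipticOp A B (fun v => f v + c * g v) u = ellipticOp A B f u + c * ellipticOp A B g u := by
  have h1 : ∀ k, pderiv k (fun v => f v + c * g v) =ᶠ[𝓝 u]
      fun v => pderiv k f v + c * pderiv k g v := by
    intro k
    filter_upwards [hf.eventually (by simp), hg.eventually (by simp)] with v hv hv'
    have e1 : DifferentiableAt ℝ f v := hv.differentiableAt (by simp)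
    have e2 : DifferentiableAt ℝ g v := hv'.differentiableAt (by simp)
    rw [pderiv_add e1 (e2.const_mul c), pderiv_const_mul c e2]
  have dp : ∀ {f : E2 → ℝ}, ContDiffAt ℝ 2 f u → ∀ a, DifferentiableAt ℝ (pderiv a f) u :=
    fun hf a => (contDiffAt_pderiv (m := 1) hf (by norm_num) a).differentiableAt (by simp)
  have h2 : ∀ k l, pderiv l (pderiv k (fun v => f v + c * g v)) u
      = pderiv l (pderiv k f) u + c * pderiv l (pderiv k g) u := by
    intro k l
    rw [pderiv_congr (h1 k), pderiv_add (dp hf k) ((dp hg k).const_mul c),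
      pderiv_const_mul c (dp hg k)]
  simp only [ellipticOp, h2, (h1 _).self_of_nhds, Fin.sum_univ_two]
  ring

/-- The Gaussian barrier centred at `c`. -/
def barrier (α : ℝ) (c u : E2) : ℝ := Real.exp (-α * ((u 0 - c 0) ^ 2 + (u 1 - c 1) ^ 2))

theorem contDiff_barrier (α : ℝ) (c : E2) : ContDiff ℝ 2 (barrier α c) := by
  have h : ∀ i, ContDiff ℝ 2 (fun u : E2 => u i) := fun i =>
    contDiff_piLp_apply (𝕜 := ℝ) (p := 2)
  exact Real.contDiff_exp.comp (contDiff_const.mul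
    ((((h 0).sub contDiff_const).pow 2).add (((h 1).sub contDiff_const).pow 2)))

theorem pderiv_coord_sub (k i : Fin 2) (c : ℝ) (u : E2) :
    pderiv k (fun v : E2 => v i - c) u = if i = k then 1 else 0 := by
  have d : DifferentiableAt ℝ (fun v : E2 => v i) u :=
    (EuclideanSpace.proj i : E2 →L[ℝ] ℝ).differentiableAt
  rw [pderiv_sub d (differentiableAt_const c), pderiv_coord, pderiv_const, sub_zero]

theorem pderiv_barrier (α : ℝ) (c : E2) (k : Fin 2) :
    pderiv k (barrier α c) = fun u => (-2 * α) * ((u k - c k) * barrier α c u) := by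
  funext u
  have d : ∀ i, DifferentiableAt ℝ (fun v : E2 => v i - c i) u := fun i =>
    (EuclideanSpace.proj i : E2 →L[ℝ] ℝ).differentiableAt.sub_const _
  have d2 : ∀ i, DifferentiableAt ℝ (fun v : E2 => (v i - c i) * (v i - c i)) u := fun i =>
    (d i).fun_mul (d i)
  unfold barrier
  simp only [pow_two]
  rw [pderiv_exp (DifferentiableAt.const_mul ((d2 0).fun_add (d2 1)) _),
    pderiv_const_mul _ ((d2 0).fun_add (d2 1)), pderiv_add (d2 0) (d2 1), pderiv_mul (d 0) (d 0),
    pderiv_mul (d 1) (d 1)]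
  simp only [pderiv_coord_sub]
  fin_cases k <;> simp <;> ring

theorem pderiv_pderiv_barrier (α : ℝ) (c u : E2) (i k : Fin 2) :
    pderiv i (pderiv k (barrier α c)) u
      = (4 * α ^ 2 * ((u i - c i) * (u k - c k)) - 2 * α * (if k = i then 1 else 0))
        * barrier α c u := by
  have d : DifferentiableAt ℝ (fun v : E2 => v k - c k) u :=
    (EuclideanSpace.proj k : E2 →L[ℝ] ℝ).differentiableAt.sub_const _
  have d2 : DifferentiableAt ℝ (barrier α c) u :=
    (contDiff_barrier α c).contDiffAt.differentiableAt (by simp)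
  rw [pderiv_barrier, pderiv_const_mul _ (d.fun_mul d2), pderiv_mul d d2, pderiv_coord_sub,
    pderiv_barrier]
  ring

/-- Away from the centre the part quadratic in `α` is positive by ellipticity, and it dominates the
linear part for large `α`. -/
theorem ellipticOp_barrier (α : ℝ) (c u : E2) :
    ellipticOp A B (barrier α c) u
      = 2 * α * (2 * α * (∑ i, ∑ j, A u i j * ((u i - c i) * (u j - c j)))
        - (∑ i, A u i i + ∑ k, B k u * (u k - c k))) * barrier α c u := by
  simp only [ellipticOp, pderiv_pderiv_barrier]
  simp only [pderiv_barrier, Fin.sum_univ_two]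
  simp
  ring

theorem barrier_eq (α : ℝ) (c u : E2) : barrier α c u = Real.exp (-α * dist u c ^ 2) := by
  rw [barrier, EuclideanSpace.dist_eq, Real.sq_sqrt (by positivity)]
  simp [Fin.sum_univ_two, Real.dist_eq, sq_abs]

theorem posDef_quadratic_pos {P : Matrix (Fin 2) (Fin 2) ℝ} (hP : P.PosDef) {c u : E2}
    (hu : u ≠ c) : 0 < ∑ i, ∑ j, P i j * ((u i - c i) * (u j - c j)) := by
  have h := hP.dotProduct_mulVec_pos (x := WithLp.ofLp (u - c))
    (fun h => hu (sub_eq_zero.mp ((WithLp.ofLp_eq_zero 2).mp h)))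
  simp only [Matrix.mulVec, dotProduct, Fin.sum_univ_two, star_trivial, Pi.star_apply,
    WithLp.ofLp_sub, Pi.sub_apply] at h ⊢
  linarith

/-- By the parallelogram law, a ball having `[a, z]` as diameter direction, centred at the midpoint
`c`, lies inside the ball about `a` through `z` and touches its boundary only at `z`. -/
theorem dist_lt_of_mem_inner_ball {a z c u : E2} {r : ℝ} (hr : dist z c = r) (hc : z - c = c - a)
    (hu : dist u c ≤ r) (huz : u ≠ z) : dist u a < 2 * r := by
  have h := parallelogram_law_with_norm ℝ (u - c) (z - c)
  have h1 : u - c + (z - c) = u - a := by rw [hc]; abel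
  have h2 : u - c - (z - c) = u - z := by abel
  rw [h1, h2, ← dist_eq_norm, ← dist_eq_norm, ← dist_eq_norm, ← dist_eq_norm, hr] at h
  have h3 : 0 < dist u z := dist_pos.mpr huz
  have h4 : 0 ≤ r := hr ▸ dist_nonneg
  have h5 : 0 ≤ dist u c := dist_nonneg
  have h6 : 0 ≤ dist u a := dist_nonneg
  nlinarith

/-- A suitable barrier is a strict subsolution away from its centre. -/
theorem exists_barrier_pos {K : Set E2} (hK : IsCompact K) {c : E2} (hc : c ∉ K)
    (hA : ∀ i j, ContinuousOn (fun u => A u i j) K) (hB : ∀ k, ContinuousOn (B k) K)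
    (hpos : ∀ u ∈ K, (A u).PosDef) :
    ∃ α, 0 < α ∧ ∀ u ∈ K, 0 < ellipticOp A B (barrier α c) u := by
  have hcoord : ∀ i, ContinuousOn (fun u : E2 => u i - c i) K := fun i => by fun_prop
  have hQ : ContinuousOn (fun u => ∑ i, ∑ j, A u i j * ((u i - c i) * (u j - c j))) K :=
    continuousOn_finsetSum _ fun i _ => continuousOn_finsetSum _ fun j _ =>
      (hA i j).mul ((hcoord i).mul (hcoord j))
  have hR : ContinuousOn (fun u => ∑ i, A u i i + ∑ k, B k u * (u k - c k)) K :=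
    (continuousOn_finsetSum _ fun i _ => hA i i).add
      (continuousOn_finsetSum _ fun k _ => (hB k).mul (hcoord k))
  rcases K.eq_empty_or_nonempty with rfl | hne
  · exact ⟨1, one_pos, by simp⟩
  obtain ⟨a, haK, ha⟩ := hK.exists_isMinOn hne hQ
  obtain ⟨b, hbK, hb⟩ := hK.exists_isMaxOn hne hR
  have hq := posDef_quadratic_pos (hpos a haK) (c := c) (u := a) (fun h => hc (h ▸ haK))
  set q := ∑ i, ∑ j, A a i j * ((a i - c i) * (a j - c j))
  set R := ∑ i, A b i i + ∑ k, B k b * (b k - c k)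
  -- With `q` the minimum of the quadratic part and `R` the maximum of the rest, this choice gives
  -- `2 α q = |R| + 1 > R`.
  refine ⟨(|R| + 1) / (2 * q), by positivity, fun u hu => ?_⟩
  have h1 : q ≤ ∑ i, ∑ j, A u i j * ((u i - c i) * (u j - c j)) := ha hu
  have h2 : ∑ i, A u i i + ∑ k, B k u * (u k - c k) ≤ R := hb hu
  have hα : 0 < (|R| + 1) / (2 * q) := by positivity
  rw [ellipticOp_barrier]
  refine mul_pos (mul_pos (by positivity) ?_) (Real.exp_pos _)
  have h3 : 2 * ((|R| + 1) / (2 * q)) * q = |R| + 1 := by field_simp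
  have h4 := mul_le_mul_of_nonneg_left h1 (by positivity : 0 ≤ 2 * ((|R| + 1) / (2 * q)))
  have h5 := le_abs_self R
  linarith

/-- The strong maximum principle of E. Hopf, local form. -/
theorem eventually_eq_of_isMaxOn {w : E2 → ℝ} {U : Set E2} {u₀ : E2} (hU : IsOpen U) (hu₀ : u₀ ∈ U)
    (hw : ∀ u ∈ U, ContDiffAt ℝ 2 w u)
    (hA : ∀ i j, ContinuousOn (fun u => A u i j) U) (hB : ∀ k, ContinuousOn (B k) U)
    (hpos : ∀ u ∈ U, (A u).PosDef) (hop : ∀ u ∈ U, 0 ≤ ellipticOp A B w u)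
    (hmax : ∀ u ∈ U, w u ≤ w u₀) : ∀ᶠ u in 𝓝 u₀, w u = w u₀ := by
  obtain ⟨σ, hσ, hσU⟩ := Metric.nhds_basis_closedBall.mem_iff.mp (hU.mem_nhds hu₀)
  have hwc : ContinuousOn w U := fun u hu => (hw u hu).continuousAt.continuousWithinAt
  -- Half the radius ensures that the ball about `a` reaching to the nearest maximum point stays
  -- inside the ball of radius `σ`.
  filter_upwards [Metric.ball_mem_nhds u₀ (half_pos hσ)] with a ha
  by_contra hne
  have hau : dist a u₀ < σ / 2 := ha
  have hZ : IsCompact (Metric.closedBall u₀ σ ∩ w ⁻¹' {w u₀}) :=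
    (isCompact_closedBall u₀ σ).of_isClosed_subset
      ((hwc.mono hσU).preimage_isClosed_of_isClosed Metric.isClosed_closedBall isClosed_singleton)
      Set.inter_subset_left
  have hu₀Z : u₀ ∈ Metric.closedBall u₀ σ ∩ w ⁻¹' {w u₀} :=
    ⟨Metric.mem_closedBall_self hσ.le, rfl⟩
  obtain ⟨z, hz, hzd⟩ := hZ.exists_infDist_eq_dist ⟨u₀, hu₀Z⟩ a
  have hmin : ∀ u ∈ Metric.closedBall u₀ σ ∩ w ⁻¹' {w u₀}, dist a z ≤ dist a u := fun u hu =>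
    hzd ▸ Metric.infDist_le_dist_of_mem hu
  have hzw : w z = w u₀ := hz.2
  have hzU : z ∈ U := hσU hz.1
  have haz : a ≠ z := fun h => hne (h ▸ hzw)
  have hin : ∀ u, dist u a < dist a z → u ∈ U ∧ w u < w u₀ := by
    intro u hu
    have h1 : u ∈ Metric.closedBall u₀ σ := by
      have := dist_triangle u a u₀
      have := hmin u₀ hu₀Z
      exact Metric.mem_closedBall.mpr (by linarith)
    refine ⟨hσU h1, lt_of_le_of_ne (hmax u (hσU h1)) fun h => ?_⟩
    have := hmin u ⟨h1, h⟩
    rw [dist_comm] at hu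
    linarith
  -- The ball about `a` contains no maximum point but may have several on its boundary. The smaller
  -- ball about the midpoint meets the maximum set only at `z`.
  set c : E2 := midpoint ℝ a z with hcdef
  set r : ℝ := dist z c with hr
  have hc : z - c = c - a := by
    have := midpoint_add_self ℝ a z
    rw [← hcdef] at this
    rw [sub_eq_sub_iff_add_eq_add, this, add_comm]
  have hr2 : dist a z = 2 * r := by
    rw [hr, hcdef, dist_comm z, dist_midpoint_right]
    simp
  have hrpos : 0 < r := by
    have := dist_pos.mpr haz
    linarith
  have hin' : ∀ u, dist u c ≤ r → u ≠ z → w u < w u₀ := fun u h1 h2 =>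
    (hin u (hr2 ▸ dist_lt_of_mem_inner_ball hr.symm hc h1 h2)).2
  obtain ⟨s', hs', hs'U⟩ := Metric.nhds_basis_closedBall.mem_iff.mp (hU.mem_nhds hzU)
  -- The bound `r / 2` keeps the centre `c` of the barrier out of the disc about `z`.
  set s := min s' (r / 2) with hs
  have hspos : 0 < s := lt_min hs' (by linarith)
  have hKU : Metric.closedBall z s ⊆ U :=
    (Metric.closedBall_subset_closedBall (min_le_left _ _)).trans hs'U
  have hK : IsCompact (Metric.closedBall z s) := isCompact_closedBall z s
  have hcK : c ∉ Metric.closedBall z s := by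
    rw [Metric.mem_closedBall, dist_comm, ← hr]
    have : s ≤ r / 2 := min_le_right _ _
    linarith
  obtain ⟨α, hα, hbar⟩ := exists_barrier_pos hK hcK (fun i j => (hA i j).mono hKU)
    (fun k => (hB k).mono hKU) (fun u hu => hpos u (hKU hu))
  have hS : IsCompact (Metric.sphere z s ∩ Metric.closedBall c r) :=
    (isCompact_sphere z s).inter_right Metric.isClosed_closedBall
  obtain ⟨δ, hδ, hδS⟩ : ∃ δ > 0, ∀ u ∈ Metric.sphere z s ∩ Metric.closedBall c r,
      w u ≤ w u₀ - δ := by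
    rcases (Metric.sphere z s ∩ Metric.closedBall c r).eq_empty_or_nonempty with h | h
    · exact ⟨1, one_pos, by simp [h]⟩
    · obtain ⟨b, hb, hbm⟩ := hS.exists_isMaxOn h
        (hwc.mono fun u hu => hKU (Metric.sphere_subset_closedBall hu.1))
      have hbz : b ≠ z := by
        rintro rfl
        have := hb.1
        rw [Metric.mem_sphere, dist_self] at this
        linarith
      have := hin' b hb.2 hbz
      exact ⟨w u₀ - w b, by linarith, fun u hu => by have : w u ≤ w b := hbm hu; linarith⟩
  -- On the boundary of the disc about `z` this is below its value at `z`: inside the ball about `c`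
  -- the gap `δ` outweighs the perturbation, which is at most `δ / 2`; outside that ball the barrier
  -- is smaller than at `z`. So `f` has an interior maximum, where the operator is nonpositive,
  -- although it is positive on `f`.
  set f : E2 → ℝ := fun u => w u + δ / 2 * barrier α c u with hf
  have hbc : Continuous (barrier α c) := (contDiff_barrier α c).continuous
  obtain ⟨m, hmK, hm⟩ := hK.exists_isMaxOn ⟨z, Metric.mem_closedBall_self hspos.le⟩
    ((hwc.mono hKU).add (continuousOn_const.mul hbc.continuousOn) : ContinuousOn f _)
  have hzm : f z ≤ f m := hm (Metric.mem_closedBall_self hspos.le)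
  have hbz : barrier α c z = Real.exp (-α * r ^ 2) := by rw [barrier_eq, ← hr]
  have hms : m ∉ Metric.sphere z s := by
    intro hms
    have hle : f m < f z := by
      simp only [hf, hbz, hzw]
      by_cases hmr : dist m c ≤ r
      · have h1 := hδS m ⟨hms, hmr⟩
        have h2 : barrier α c m ≤ 1 := by
          rw [barrier_eq]
          exact Real.exp_le_one_iff.mpr (by nlinarith [sq_nonneg (dist m c)])
        have h3 := Real.exp_pos (-α * r ^ 2)
        nlinarith
      · push Not at hmr
        have h1 := hmax m (hKU hmK)
        have h2 : barrier α c m < Real.exp (-α * r ^ 2) := by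
          rw [barrier_eq]
          exact Real.exp_lt_exp.mpr (by nlinarith [mul_pos hα (sub_pos.mpr hmr)])
        nlinarith
    linarith
  have hmball : m ∈ Metric.ball z s :=
    lt_of_le_of_ne (Metric.mem_closedBall.mp hmK) fun h => hms h
  have hlm : IsLocalMax f m :=
    hm.isLocalMax (Filter.mem_of_superset (Metric.isOpen_ball.mem_nhds hmball)
      Metric.ball_subset_closedBall)
  have hmU := hKU hmK
  have h1 := ellipticOp_nonpos_of_isLocalMax (B := B) (hpos m hmU)
    ((hw m hmU).add (contDiffAt_const.mul (contDiff_barrier α c).contDiffAt) :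
      ContDiffAt ℝ 2 f m) hlm
  rw [ellipticOp_add _ (hw m hmU) (contDiff_barrier α c).contDiffAt] at h1
  have h2 := hop m hmU
  have h3 := mul_pos (half_pos hδ) (hbar m hmK)
  linarith

end MaximumPrinciple

/-! ### Parametrized surfaces with a transversal field -/

section Patch

theorem metricCurvature_congr {G G' : E2 → Matrix (Fin 2) (Fin 2) ℝ} {u : E2} (h : G =ᶠ[𝓝 u] G') :
    metricCurvature G u = metricCurvature G' u := by
  have h1 : ∀ k i j, christoffel G k i j =ᶠ[𝓝 u] christoffel G' k i j := by
    intro k i j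
    filter_upwards [h.eventuallyEq_nhds] with v hv
    have hd : ∀ m a b, pderiv m (fun v => G v a b) v = pderiv m (fun v => G' v a b) v :=
      fun m a b => pderiv_congr (hv.mono fun w hw => by rw [hw]) m
    simp only [christoffel, hd, hv.self_of_nhds]
  simp only [metricCurvature, ricci, riemann, pderiv_congr (h1 _ _ _), (h1 _ _ _).self_of_nhds,
    h.self_of_nhds]

variable {r r' η η' ζ : E2 → E3} {τ : E2 → E2} {u : E2}

theorem inner_eq_sum (a b : E3) : inner ℝ a b = a 0 * b 0 + a 1 * b 1 + a 2 * b 2 := by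
  simp [PiLp.inner_apply, Fin.sum_univ_three, mul_comm]

theorem crossNormal_apply (r : E2 → E3) (u : E2) :
    crossNormal r u 0 = pderiv 0 r u 1 * pderiv 1 r u 2 - pderiv 0 r u 2 * pderiv 1 r u 1 ∧
    crossNormal r u 1 = pderiv 0 r u 2 * pderiv 1 r u 0 - pderiv 0 r u 0 * pderiv 1 r u 2 ∧
    crossNormal r u 2 = pderiv 0 r u 0 * pderiv 1 r u 1 - pderiv 0 r u 1 * pderiv 1 r u 0 := by
  simp [crossNormal, cross_apply]

theorem inner_crossNormal_pderiv (r : E2 → E3) (u : E2) (i : Fin 2) :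
    inner ℝ (crossNormal r u) (pderiv i r u) = 0 := by
  obtain ⟨h0, h1, h2⟩ := crossNormal_apply r u
  rw [inner_eq_sum, h0, h1, h2]
  fin_cases i <;> simp <;> ring

theorem det_firstForm (r : E2 → E3) (u : E2) :
    (firstForm r u).det = ‖crossNormal r u‖ ^ 2 := by
  obtain ⟨h0, h1, h2⟩ := crossNormal_apply r u
  rw [← real_inner_self_eq_norm_sq, Matrix.det_fin_two]
  simp only [firstForm, Matrix.of_apply, inner_eq_sum, h0, h1, h2]
  ring

/-- Decomposition of a vector with respect to the tangent vectors and the normal. -/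
theorem norm_sq_smul_eq (r : E2 → E3) (u : E2) (d : E3) : ∃ a b : ℝ,
    ‖crossNormal r u‖ ^ 2 • d = a • pderiv 0 r u + b • pderiv 1 r u
      + (inner ℝ (crossNormal r u) d) • crossNormal r u := by
  obtain ⟨h0, h1, h2⟩ := crossNormal_apply r u
  refine ⟨inner ℝ d (pderiv 0 r u) * inner ℝ (pderiv 1 r u) (pderiv 1 r u)
      - inner ℝ d (pderiv 1 r u) * inner ℝ (pderiv 0 r u) (pderiv 1 r u),
    inner ℝ d (pderiv 1 r u) * inner ℝ (pderiv 0 r u) (pderiv 0 r u)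
      - inner ℝ d (pderiv 0 r u) * inner ℝ (pderiv 0 r u) (pderiv 1 r u), ?_⟩
  rw [← real_inner_self_eq_norm_sq]
  ext i
  simp only [inner_eq_sum, PiLp.smul_apply, PiLp.add_apply, smul_eq_mul]
  fin_cases i <;> simp only [Fin.zero_eta, Fin.mk_one, Fin.reduceFinMk, h0, h1, h2] <;> ring

theorem exists_tangent_of_inner_eq_zero {d : E3} (hn : crossNormal r u ≠ 0)
    (hd : inner ℝ (crossNormal r u) d = 0) :
    ∃ a b : ℝ, d = a • pderiv 0 r u + b • pderiv 1 r u := by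
  obtain ⟨a, b, h⟩ := norm_sq_smul_eq r u d
  have hn' : ‖crossNormal r u‖ ^ 2 ≠ 0 := pow_ne_zero 2 (norm_ne_zero_iff.mpr hn)
  refine ⟨(‖crossNormal r u‖ ^ 2)⁻¹ * a, (‖crossNormal r u‖ ^ 2)⁻¹ * b, ?_⟩
  rw [hd, zero_smul, add_zero] at h
  rw [mul_smul, mul_smul, ← smul_add, ← h, smul_smul, inv_mul_cancel₀ hn', one_smul]

/-- The squared norm of the cross product is the Gram determinant, and a kernel vector of the Gram
matrix is a linear relation between the tangent vectors. -/
theorem crossNormal_ne_zero (h : ∀ a b : ℝ, a • pderiv 0 r u + b • pderiv 1 r u = 0 → a = 0 ∧ b = 0) :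
    crossNormal r u ≠ 0 := by
  intro hn
  have hg : (firstForm r u).det = 0 := by rw [det_firstForm, hn]; simp
  obtain ⟨v, hv, hv0⟩ := Matrix.exists_mulVec_eq_zero_iff.mpr hg
  have h0 := congrFun hv0 0
  have h1 := congrFun hv0 1
  simp only [Matrix.mulVec, dotProduct, Fin.sum_univ_two, firstForm, Matrix.of_apply,
    Pi.zero_apply] at h0 h1
  have h2 : v 0 • pderiv 0 r u + v 1 • pderiv 1 r u = 0 := by
    rw [← inner_self_eq_zero (𝕜 := ℝ)]
    simp only [inner_add_left, inner_add_right, real_inner_smul_left, real_inner_smul_right]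
    linear_combination v 0 * h0 + v 1 * h1
  obtain ⟨ha, hb⟩ := h _ _ h2
  exact hv (by funext i; fin_cases i; exacts [ha, hb])

theorem normalForm_smul (r : E2 → E3) (c : ℝ) (N : E3) (u : E2) :
    normalForm r (c • N) u = c • normalForm r N u := by
  ext i j
  simp [normalForm, real_inner_smul_left]

theorem normalForm_isSymm (hr : ContDiffAt ℝ 2 r u) (N : E3) : (normalForm r N u).IsSymm := by
  ext i j
  simp only [normalForm, Matrix.transpose_apply, Matrix.of_apply]
  rw [pderiv_comm hr]

theorem localGaussCurvature_eq (r : E2 → E3) (u : E2) : localGaussCurvature r u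
    = (‖crossNormal r u‖⁻¹) ^ 4 * (normalForm r (crossNormal r u) u).det := by
  rw [localGaussCurvature, normalForm_smul, Matrix.det_smul, det_firstForm, Fintype.card_fin]
  rw [div_eq_mul_inv, inv_pow, inv_pow]
  have : (‖crossNormal r u‖ ^ 4)⁻¹ = (‖crossNormal r u‖ ^ 2)⁻¹ * (‖crossNormal r u‖ ^ 2)⁻¹ := by
    rw [← mul_inv, ← pow_add]
  rw [this]
  ring

theorem contDiffAt_crossNormal {m n : WithTop ℕ∞} (hr : ContDiffAt ℝ n r u) (hmn : m + 1 ≤ n) :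
    ContDiffAt ℝ m (crossNormal r) u := by
  have h : ∀ i k, ContDiffAt ℝ m (fun v => pderiv i r v k) u := fun i k =>
    (contDiffAt_piLp 2).mp (contDiffAt_pderiv hr hmn i) k
  refine contDiffAt_piLp' 2 fun k => ?_
  fin_cases k <;> simp only [Fin.zero_eta, Fin.mk_one, Fin.reduceFinMk, (crossNormal_apply r _).1,
    (crossNormal_apply r _).2.1, (crossNormal_apply r _).2.2]
  · exact ((h 0 1).mul (h 1 2)).sub ((h 0 2).mul (h 1 1))
  · exact ((h 0 2).mul (h 1 0)).sub ((h 0 0).mul (h 1 2))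
  · exact ((h 0 0).mul (h 1 1)).sub ((h 0 1).mul (h 1 0))

/-- A parametrized surface of positive curvature with a relative normalization. -/
structure IsPatch (r η : E2 → E3) (U : Set E2) : Prop where
  isOpen : IsOpen U
  contDiffAt : ∀ u ∈ U, ContDiffAt ℝ 4 r u
  contDiffAt_normalization : ∀ u ∈ U, ContDiffAt ℝ 1 η u
  regular : ∀ u ∈ U, crossNormal r u ≠ 0
  transversal : ∀ u ∈ U, inner ℝ (crossNormal r u) (η u) ≠ 0
  tangent : ∀ u ∈ U, ∀ i, inner ℝ (crossNormal r u) (pderiv i η u) = 0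
  curvature_pos : ∀ u ∈ U, 0 < localGaussCurvature r u

/-- The support function with respect to the Euclidean unit normal. -/
def localSupport (r η : E2 → E3) (u : E2) : ℝ := ‖localCovector r η u‖⁻¹

/-- The logarithm of the quotient of the support functions of `η` and of the equiaffine
normalization. -/
def logSupportRatio (r η : E2 → E3) (u : E2) : ℝ :=
  Real.log (localSupport r η u / localQAff r u)

/-- Lets second-order regularity be read off a formula for the first derivatives, for functions
built from data that are only C^1. -/
theorem contDiffAt_two_of_pderiv {f : E2 → ℝ} (hd : ∀ᶠ v in 𝓝 u, DifferentiableAt ℝ f v)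
    (hp : ∀ i, ContDiffAt ℝ 1 (pderiv i f) u) : ContDiffAt ℝ 2 f u := by
  have h : ContDiffAt ℝ ((1 : ℕ) + 1) f u := by
    refine contDiffAt_succ_iff_hasFDerivAt.mpr
      ⟨fun v => pderiv 0 f v • (EuclideanSpace.proj 0 : E2 →L[ℝ] ℝ)
        + pderiv 1 f v • (EuclideanSpace.proj 1 : E2 →L[ℝ] ℝ), ⟨_, hd, fun v hv => ?_⟩, ?_⟩
    · have h1 : fderiv ℝ f v = pderiv 0 f v • (EuclideanSpace.proj 0 : E2 →L[ℝ] ℝ)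
        + pderiv 1 f v • (EuclideanSpace.proj 1 : E2 →L[ℝ] ℝ) := by
        ext w
        rw [fderiv_eq_sum_pderiv]
        simp [mul_comm]
      have h2 := DifferentiableAt.hasFDerivAt hv
      rw [h1] at h2
      exact h2
    · exact ((hp 0).smul contDiffAt_const).add ((hp 1).smul contDiffAt_const)
  exact h

theorem posDef_fin_two {P : Matrix (Fin 2) (Fin 2) ℝ} (hs : P.IsSymm) (ha : 0 < P 0 0)
    (hd : 0 < P.det) : P.PosDef := by
  have h10 : P 1 0 = P 0 1 := hs.apply 0 1
  refine Matrix.PosDef.of_dotProduct_mulVec_pos (by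
    rw [Matrix.IsHermitian, Matrix.conjTranspose_eq_transpose_of_trivial]; exact hs) fun x hx => ?_
  rw [Matrix.det_fin_two, h10] at hd
  simp only [Matrix.mulVec, dotProduct, Fin.sum_univ_two, star_trivial, Pi.star_apply, h10]
  have h1 : P 0 0 * (x 0 * (P 0 0 * x 0 + P 0 1 * x 1) + x 1 * (P 0 1 * x 0 + P 1 1 * x 1))
      = (P 0 0 * x 0 + P 0 1 * x 1) ^ 2 + (P 0 0 * P 1 1 - P 0 1 * P 0 1) * x 1 ^ 2 := by ring
  refine pos_of_mul_pos_right (a := P 0 0) ?_ ha.le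
  rw [h1]
  by_cases hx1 : x 1 = 0
  · have hx0 : x 0 ≠ 0 := fun h => hx (by funext i; fin_cases i; exacts [h, hx1])
    rw [hx1, mul_zero, add_zero]
    have := mul_ne_zero ha.ne' hx0
    positivity
  · exact add_pos_of_nonneg_of_pos (sq_nonneg _) (mul_pos hd (by positivity))

theorem inner_crossNormal_localUnitNormal (r η : E2 → E3) (u : E2) :
    inner ℝ (crossNormal r u) (localUnitNormal r η u)
      = ‖localCovector r η u‖⁻¹ * ((inner ℝ (crossNormal r u) (η u))⁻¹ * ‖crossNormal r u‖ ^ 2) := by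
  rw [localUnitNormal, localCovector, real_inner_smul_right, real_inner_smul_right,
    real_inner_self_eq_norm_sq]

theorem inner_localUnitNormal_pderiv (r η : E2 → E3) (u : E2) (i : Fin 2) :
    inner ℝ (localUnitNormal r η u) (pderiv i r u) = 0 := by
  rw [localUnitNormal, localCovector, real_inner_smul_left, real_inner_smul_left,
    inner_crossNormal_pderiv]
  simp

theorem inner_crossNormal_localEquiaffine (r η : E2 → E3) (u : E2) :
    inner ℝ (crossNormal r u) (localEquiaffine r η u)
      = localQAff r u * inner ℝ (crossNormal r u) (localUnitNormal r η u) := by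
  simp [localEquiaffine, inner_sub_right, inner_add_right, real_inner_smul_right, Fin.sum_univ_two,
    inner_crossNormal_pderiv]

theorem norm_localCovector (r η : E2 → E3) (u : E2) : ‖localCovector r η u‖
    = |inner ℝ (crossNormal r u) (η u)|⁻¹ * ‖crossNormal r u‖ := by
  rw [localCovector, norm_smul, norm_inv, Real.norm_eq_abs]

/-! ### Regularity, conformal relation and recovery of the normalization on a patch -/

namespace IsPatch

variable {U : Set E2} (hP : IsPatch r η U)
include hP

theorem det_normalForm_pos (hu : u ∈ U) : 0 < (normalForm r (crossNormal r u) u).det := by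
  have h := hP.curvature_pos u hu
  rw [localGaussCurvature_eq] at h
  exact pos_of_mul_pos_right h (by positivity)

theorem localCovector_ne_zero (hu : u ∈ U) : localCovector r η u ≠ 0 :=
  smul_ne_zero (inv_ne_zero (hP.transversal u hu)) (hP.regular u hu)

theorem localSupport_pos (hu : u ∈ U) : 0 < localSupport r η u :=
  inv_pos.mpr (norm_pos_iff.mpr (hP.localCovector_ne_zero hu))

theorem localQAff_pos (hu : u ∈ U) : 0 < localQAff r u :=
  Real.rpow_pos_of_pos (abs_pos.mpr (hP.curvature_pos u hu).ne') _

theorem exp_logSupportRatio (hu : u ∈ U) :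
    Real.exp (logSupportRatio r η u) = localSupport r η u / localQAff r u :=
  Real.exp_log (div_pos (hP.localSupport_pos hu) (hP.localQAff_pos hu))

theorem contDiffAt_crossNormal (hu : u ∈ U) : ContDiffAt ℝ 3 (crossNormal r) u :=
  RelGeom.contDiffAt_crossNormal (hP.contDiffAt u hu) (by norm_num)

/-- One order of regularity is gained from tangency: with `N` the cross product, `∂⟨N, η⟩ = ⟨∂N, η⟩`
contains no derivative of `η` and is therefore again C^1. -/
theorem contDiffAt_inner (hu : u ∈ U) :
    ContDiffAt ℝ 2 (fun v => inner ℝ (crossNormal r v) (η v)) u := by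
  have hU := hP.isOpen.mem_nhds hu
  have d1 : ∀ v ∈ U, DifferentiableAt ℝ (crossNormal r) v := fun v hv =>
    (hP.contDiffAt_crossNormal hv).differentiableAt (by simp)
  have d2 : ∀ v ∈ U, DifferentiableAt ℝ η v := fun v hv =>
    (hP.contDiffAt_normalization v hv).differentiableAt (by simp)
  refine contDiffAt_two_of_pderiv ?_ fun i => ?_
  · filter_upwards [hU] with v hv
    exact (d1 v hv).inner ℝ (d2 v hv)
  · have h : pderiv i (fun v => inner ℝ (crossNormal r v) (η v)) =ᶠ[𝓝 u]
        fun v => inner ℝ (pderiv i (crossNormal r) v) (η v) := by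
      filter_upwards [hU] with v hv
      rw [pderiv_inner (d1 v hv) (d2 v hv), hP.tangent v hv, add_zero]
    refine ContDiffAt.congr_of_eventuallyEq ?_ h
    exact (contDiffAt_pderiv (hP.contDiffAt_crossNormal hu) (by norm_num) i).inner ℝ
      (hP.contDiffAt_normalization u hu)

theorem contDiffAt_localCovector (hu : u ∈ U) : ContDiffAt ℝ 2 (localCovector r η) u :=
  ((hP.contDiffAt_inner hu).inv (hP.transversal u hu)).smul
    ((hP.contDiffAt_crossNormal hu).of_le (by norm_num))

theorem contDiffAt_normalForm {N : E2 → E3} (hu : u ∈ U) (hN : ContDiffAt ℝ 2 N u) (i j : Fin 2) :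
    ContDiffAt ℝ 2 (fun v => normalForm r (N v) v i j) u :=
  hN.inner ℝ (contDiffAt_pderiv (m := 2)
    (contDiffAt_pderiv (m := 3) (hP.contDiffAt u hu) (by norm_num) i) (by norm_num) j)

theorem contDiffAt_localRelMetric (hu : u ∈ U) (i j : Fin 2) :
    ContDiffAt ℝ 2 (fun v => localRelMetric r η v i j) u :=
  hP.contDiffAt_normalForm hu (hP.contDiffAt_localCovector hu) i j

theorem localRelMetric_isSymm (hu : u ∈ U) : (localRelMetric r η u).IsSymm :=
  normalForm_isSymm ((hP.contDiffAt u hu).of_le (by norm_num)) _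

theorem eventually_localRelMetric_isSymm (hu : u ∈ U) :
    ∀ᶠ v in 𝓝 u, (localRelMetric r η v).IsSymm := by
  filter_upwards [hP.isOpen.mem_nhds hu] with v hv using hP.localRelMetric_isSymm hv

/-- In dimension two rescaling the normal multiplies the determinant by a square, so the sign is
that of the Gaussian curvature. This says definite, not positive definite. -/
theorem det_localRelMetric_pos (hu : u ∈ U) : 0 < (localRelMetric r η u).det := by
  rw [localRelMetric, localCovector, normalForm_smul, Matrix.det_smul, Fintype.card_fin]
  have h1 := hP.det_normalForm_pos hu
  have h2 := inv_ne_zero (hP.transversal u hu)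
  positivity

theorem localRelMetric_apply_ne_zero (hu : u ∈ U) : localRelMetric r η u 0 0 ≠ 0 := by
  intro h
  have h1 := hP.det_localRelMetric_pos hu
  rw [Matrix.det_fin_two, h, (hP.localRelMetric_isSymm hu).apply 0 1] at h1
  nlinarith

theorem contDiffAt_localSupport (hu : u ∈ U) : ContDiffAt ℝ 2 (localSupport r η) u :=
  ((hP.contDiffAt_localCovector hu).norm ℝ (hP.localCovector_ne_zero hu)).inv
    (norm_ne_zero_iff.mpr (hP.localCovector_ne_zero hu))

theorem contDiffAt_localGaussCurvature (hu : u ∈ U) : ContDiffAt ℝ 2 (localGaussCurvature r) u := by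
  have hn : ContDiffAt ℝ 2 (crossNormal r) u := (hP.contDiffAt_crossNormal hu).of_le (by norm_num)
  have h : localGaussCurvature r = fun u =>
      (‖crossNormal r u‖⁻¹) ^ 4 * (normalForm r (crossNormal r u) u).det :=
    funext (localGaussCurvature_eq r)
  rw [h]
  exact (((hn.norm ℝ (hP.regular u hu)).inv (norm_ne_zero_iff.mpr (hP.regular u hu))).pow 4).mul
    (contDiffAt_det fun i j => hP.contDiffAt_normalForm hu hn i j)

theorem contDiffAt_localQAff (hu : u ∈ U) : ContDiffAt ℝ 2 (localQAff r) u := by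
  have hK := (hP.curvature_pos u hu).ne'
  exact ((contDiffAt_abs hK).comp u (hP.contDiffAt_localGaussCurvature hu)).rpow_const_of_ne
    (abs_ne_zero.mpr hK)

theorem contDiffAt_logSupportRatio (hu : u ∈ U) : ContDiffAt ℝ 2 (logSupportRatio r η) u :=
  ((hP.contDiffAt_localSupport hu).div (hP.contDiffAt_localQAff hu) (hP.localQAff_pos hu).ne').log
    (div_pos (hP.localSupport_pos hu) (hP.localQAff_pos hu)).ne'

/-- Only the normal component of `ζ` enters its covector. Allowing any such `ζ` covers the
equiaffine field of the whole surface, whose values near a point are computed in other charts. -/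
theorem localCovector_of_inner_eq (hu : u ∈ U) (hζ : inner ℝ (crossNormal r u) (ζ u)
      = localQAff r u * inner ℝ (crossNormal r u) (localUnitNormal r η u)) :
    localCovector r ζ u = Real.exp (logSupportRatio r η u) • localCovector r η u := by
  rw [hP.exp_logSupportRatio hu, localSupport, localCovector, hζ, inner_crossNormal_localUnitNormal,
    norm_localCovector, localCovector, smul_smul]
  congr 1
  have h1 := (hP.localQAff_pos hu).ne'
  have h2 := norm_ne_zero_iff.mpr (hP.regular u hu)
  have h3 := hP.transversal u hu
  have h4 := abs_ne_zero.mpr h3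
  have h5 := abs_mul_abs_self (inner ℝ (crossNormal r u) (η u))
  field_simp
  linear_combination -h5

/-- The curvature of the relative metric of a normalization with the equiaffine support
function. -/
theorem metricCurvature_of_inner_eq (hu : u ∈ U)
    (hζ : ∀ᶠ v in 𝓝 u, inner ℝ (crossNormal r v) (ζ v)
      = localQAff r v * inner ℝ (crossNormal r v) (localUnitNormal r η v)) :
    metricCurvature (localRelMetric r η) u / localSupport r η u
        - metricCurvature (localRelMetric r ζ) u / localQAff r u
      = metricLaplacian (localRelMetric r η) (logSupportRatio r η) u
        / (2 * localSupport r η u) := by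
  have h : localRelMetric r ζ =ᶠ[𝓝 u]
      fun v => Real.exp (logSupportRatio r η v) • localRelMetric r η v := by
    filter_upwards [hζ, hP.isOpen.mem_nhds hu] with v hv hvU
    rw [localRelMetric, hP.localCovector_of_inner_eq hvU hv, normalForm_smul, localRelMetric]
  rw [metricCurvature_congr h, metricCurvature_conformal (hP.contDiffAt_localRelMetric hu)
    (hP.eventually_localRelMetric_isSymm hu) (hP.det_localRelMetric_pos hu).ne'
    (hP.contDiffAt_logSupportRatio hu), Real.exp_neg, hP.exp_logSupportRatio hu]
  have h1 := (hP.localQAff_pos hu).ne'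
  have h2 := (hP.localSupport_pos hu).ne'
  field_simp
  ring

theorem inner_localUnitNormal_self (hu : u ∈ U) :
    inner ℝ (localUnitNormal r η u) (localUnitNormal r η u) = (1 : ℝ) := by
  have h := norm_ne_zero_iff.mpr (hP.localCovector_ne_zero hu)
  rw [localUnitNormal, real_inner_smul_left, real_inner_smul_right, real_inner_self_eq_norm_sq]
  field_simp

theorem inner_localUnitNormal_normalization (hu : u ∈ U) :
    inner ℝ (localUnitNormal r η u) (η u) = localSupport r η u := by
  rw [localUnitNormal, localCovector, real_inner_smul_left, real_inner_smul_left,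
    inv_mul_cancel₀ (hP.transversal u hu), mul_one]
  rfl

theorem contDiffAt_localUnitNormal (hu : u ∈ U) : ContDiffAt ℝ 2 (localUnitNormal r η) u :=
  (hP.contDiffAt_localSupport hu).smul (hP.contDiffAt_localCovector hu)

theorem det_normalForm_localUnitNormal_ne_zero (hu : u ∈ U) :
    (normalForm r (localUnitNormal r η u) u).det ≠ 0 := by
  rw [localUnitNormal, normalForm_smul, Matrix.det_smul, Fintype.card_fin]
  exact mul_ne_zero (pow_ne_zero 2 (hP.localSupport_pos hu).ne') (hP.det_localRelMetric_pos hu).ne'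

/-- A relative normalization is determined by its support function. -/
theorem eq_smul_localEquiaffine {c : ℝ} (hu : u ∈ U)
    (hc : ∀ᶠ v in 𝓝 u, localSupport r η v = c * localQAff r v) :
    η u = c • localEquiaffine r η u := by
  have hU := hP.isOpen.mem_nhds hu
  set ξ := localUnitNormal r η with hξ
  set h := normalForm r (ξ u) u with hh
  have dξ : DifferentiableAt ℝ ξ u := (hP.contDiffAt_localUnitNormal hu).differentiableAt (by simp)
  have dη : DifferentiableAt ℝ η u :=
    (hP.contDiffAt_normalization u hu).differentiableAt (by simp)
  have dr : ∀ j, DifferentiableAt ℝ (pderiv j r) u := fun j =>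
    (contDiffAt_pderiv (m := 3) (hP.contDiffAt u hu) (by norm_num) j).differentiableAt (by simp)
  -- Differentiate `⟨ξ, η⟩ = c q_aff`; the other product-rule term vanishes because `∂η` is tangent.
  have hξη : ∀ k, inner ℝ (pderiv k ξ u) (η u) = c * pderiv k (localQAff r) u := by
    intro k
    have h1 : (fun v => inner ℝ (ξ v) (η v)) =ᶠ[𝓝 u] fun v => c * localQAff r v := by
      filter_upwards [hU, hc] with v hv hcv
      rw [← hcv]
      exact hP.inner_localUnitNormal_normalization hv
    have h2 : inner ℝ (ξ u) (pderiv k η u) = 0 := by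
      rw [hξ, localUnitNormal, localCovector, real_inner_smul_left, real_inner_smul_left,
        hP.tangent u hu]
      simp
    rw [← pderiv_const_mul c ((hP.contDiffAt_localQAff hu).differentiableAt (by simp)),
      ← pderiv_congr h1, pderiv_inner dξ dη, h2, add_zero]
  -- The Weingarten relation, from differentiating `⟨ξ, r_j⟩ = 0`.
  have hξr : ∀ k j, inner ℝ (pderiv k ξ u) (pderiv j r u) = - h j k := by
    intro k j
    have h1 : (fun v => inner ℝ (ξ v) (pderiv j r v)) = fun _ => (0 : ℝ) :=
      funext fun v => inner_localUnitNormal_pderiv r η v j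
    have h2 := pderiv_inner dξ (dr j) k
    rw [h1, pderiv_const] at h2
    have h3 : h j k = inner ℝ (ξ u) (pderiv k (pderiv j r) u) := rfl
    rw [h3]
    linarith
  have hξξ : ∀ k, inner ℝ (pderiv k ξ u) (ξ u) = (0 : ℝ) := by
    intro k
    have h1 : (fun v => inner ℝ (ξ v) (ξ v)) =ᶠ[𝓝 u] fun _ => (1 : ℝ) := by
      filter_upwards [hU] with v hv using hP.inner_localUnitNormal_self hv
    have h2 := pderiv_inner dξ dξ k
    rw [pderiv_congr h1, pderiv_const, real_inner_comm (pderiv k ξ u)] at h2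
    linarith
  have hdet : h.det ≠ 0 := hP.det_normalForm_localUnitNormal_ne_zero hu
  have hsym : h.IsSymm := normalForm_isSymm ((hP.contDiffAt u hu).of_le (by norm_num)) _
  -- Read directly off the defining formula, so the equiaffine field itself is never differentiated.
  have hξa : ∀ k, inner ℝ (pderiv k ξ u) (localEquiaffine r η u) = pderiv k (localQAff r) u := by
    intro k
    have h1 := congrFun (congrArg (fun A => Matrix.vecMul (fun i => pderiv i (localQAff r) u) A)
      (Matrix.nonsing_inv_mul h hdet.isUnit)) k
    simp only [Matrix.vecMul_one] at h1
    rw [← h1]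
    simp only [localEquiaffine, inner_sub_right, inner_add_right, real_inner_smul_right,
      Fin.sum_univ_two, ← hξ, ← hh, hξξ, hξr, Matrix.vecMul, dotProduct, Matrix.mul_apply]
    ring
  have hd : inner ℝ (crossNormal r u) (η u - c • localEquiaffine r η u) = 0 := by
    have h1 := hc.self_of_nhds
    have h2 := hP.inner_localUnitNormal_normalization hu
    have h3 := hP.inner_localUnitNormal_self hu
    have h4 : ∃ t : ℝ, t ≠ 0 ∧ localUnitNormal r η u = t • crossNormal r u := by
      refine ⟨localSupport r η u * (inner ℝ (crossNormal r u) (η u))⁻¹,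
        mul_ne_zero (hP.localSupport_pos hu).ne' (inv_ne_zero (hP.transversal u hu)), ?_⟩
      rw [mul_smul]
      rfl
    obtain ⟨t, ht, h4⟩ := h4
    rw [inner_sub_right, real_inner_smul_right, inner_crossNormal_localEquiaffine]
    refine mul_left_cancel₀ ht ?_
    rw [h4, real_inner_smul_left] at h2 h3
    rw [h4]
    linear_combination h2 - c * localQAff r u * h3 + h1
  obtain ⟨a, b, hab⟩ := exists_tangent_of_inner_eq_zero (hP.regular u hu) hd
  -- The difference of the two fields is tangent and orthogonal to all derivatives of `ξ`; by
  -- Weingarten its coefficients lie in the kernel of `h`.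
  have hzero : ∀ k, h k 0 * a + h k 1 * b = 0 := by
    intro k
    have h1 : inner ℝ (pderiv k ξ u) (η u - c • localEquiaffine r η u) = 0 := by
      rw [inner_sub_right, real_inner_smul_right, hξη, hξa, sub_self]
    rw [hab, inner_add_right, real_inner_smul_right, real_inner_smul_right, hξr, hξr,
      hsym.apply k 0, hsym.apply k 1] at h1
    linarith
  have hv : h.mulVec ![a, b] = 0 := by
    funext k
    simp [Matrix.mulVec, dotProduct, Fin.sum_univ_two, hzero]
  have hv0 := Matrix.eq_zero_of_mulVec_eq_zero hdet hv
  have ha : a = 0 := congrFun hv0 0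
  have hb : b = 0 := congrFun hv0 1
  rw [ha, hb, zero_smul, zero_smul, add_zero] at hab
  exact sub_eq_zero.mp hab

end IsPatch

/-! ### Behaviour of the local invariants under reparametrization -/

section Reparametrization

variable (hr : r =ᶠ[𝓝 u] fun v => r' (τ v)) (hr' : ContDiffAt ℝ 2 r' (τ u))
  (hτ : ContDiffAt ℝ 2 τ u)
include hr hr' hτ

theorem pderiv_eq_of_comp (i : Fin 2) : pderiv i r u
    = jacobian τ u 0 i • pderiv 0 r' (τ u) + jacobian τ u 1 i • pderiv 1 r' (τ u) := by
  rw [pderiv_congr hr, pderiv_comp (hr'.differentiableAt (by simp)) (hτ.differentiableAt (by simp))]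
  rfl

theorem crossNormal_comp :
    crossNormal r u = (jacobian τ u).det • crossNormal r' (τ u) := by
  obtain ⟨h0, h1, h2⟩ := crossNormal_apply r u
  obtain ⟨h0', h1', h2'⟩ := crossNormal_apply r' (τ u)
  simp only [pderiv_eq_of_comp hr hr' hτ, PiLp.add_apply, PiLp.smul_apply, smul_eq_mul] at h0 h1 h2
  ext k
  simp only [PiLp.smul_apply, smul_eq_mul, Matrix.det_fin_two]
  fin_cases k <;> simp only [Fin.zero_eta, Fin.mk_one, Fin.reduceFinMk, h0, h1, h2, h0', h1', h2'] <;>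
    ring

/-- The second derivatives of `τ` only multiply tangent vectors, which `N` annihilates. -/
theorem normalForm_comp {N : E3} (hN : ∀ a, inner ℝ N (pderiv a r' (τ u)) = 0) :
    normalForm r N u = (jacobian τ u).transpose * normalForm r' N (τ u) * jacobian τ u := by
  have hev : ∀ i, pderiv i r =ᶠ[𝓝 u] fun v => jacobian τ v 0 i • pderiv 0 r' (τ v)
      + jacobian τ v 1 i • pderiv 1 r' (τ v) := by
    intro i
    filter_upwards [hr.eventuallyEq_nhds, hτ.eventually (by simp),
      hτ.continuousAt.eventually (hr'.eventually (by simp))] with v h1 h2 h3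
    exact pderiv_eq_of_comp h1 h3 h2 i
  have hτ' : DifferentiableAt ℝ τ u := hτ.differentiableAt (by simp)
  have dp : ∀ a, DifferentiableAt ℝ (pderiv a r') (τ u) := fun a =>
    (contDiffAt_pderiv (m := 1) hr' (by norm_num) a).differentiableAt (by simp)
  have dp' : ∀ a, DifferentiableAt ℝ (fun v => pderiv a r' (τ v)) u := fun a => (dp a).comp u hτ'
  have d1 : ∀ a i, DifferentiableAt ℝ (fun v => jacobian τ v a i) u := fun a i =>
    (contDiffAt_jacobian (m := 1) hτ (by norm_num) a i).differentiableAt (by simp)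
  have h2 : ∀ a j, pderiv j (fun v => pderiv a r' (τ v)) u
      = jacobian τ u 0 j • pderiv 0 (pderiv a r') (τ u)
        + jacobian τ u 1 j • pderiv 1 (pderiv a r') (τ u) := fun a j => pderiv_comp (dp a) hτ' j
  ext i j
  rw [congruence_apply]
  simp only [normalForm, Matrix.of_apply]
  rw [pderiv_congr (hev i), pderiv_add ((d1 _ _).fun_smul (dp' _)) ((d1 _ _).fun_smul (dp' _)),
    pderiv_smul (d1 _ _) (dp' _), pderiv_smul (d1 _ _) (dp' _), h2, h2]
  simp only [inner_add_right, real_inner_smul_right, hN]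
  ring

variable (hreg : crossNormal r u ≠ 0)
include hreg

theorem det_jacobian_ne_zero_of_comp : (jacobian τ u).det ≠ 0 := by
  intro h
  rw [crossNormal_comp hr hr' hτ, h, zero_smul] at hreg
  exact hreg rfl

/-- The Jacobian determinant in the cross product cancels, sign included, so the covector and the
unit normal do not depend on the orientation of the chart. -/
theorem localCovector_comp (hη : η u = η' (τ u)) :
    localCovector r η u = localCovector r' η' (τ u) := by
  have hd := det_jacobian_ne_zero_of_comp hr hr' hτ hreg
  rw [localCovector, localCovector, crossNormal_comp hr hr' hτ, hη, real_inner_smul_left, smul_smul]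
  congr 1
  rw [mul_inv]
  field_simp

theorem localRelMetric_comp (hη : η u = η' (τ u)) : localRelMetric r η u
    = (jacobian τ u).transpose * localRelMetric r' η' (τ u) * jacobian τ u := by
  rw [localRelMetric, localCovector_comp hr hr' hτ hreg hη, localRelMetric]
  refine normalForm_comp hr hr' hτ fun a => ?_
  rw [localCovector, real_inner_smul_left, inner_crossNormal_pderiv, mul_zero]

theorem localUnitNormal_comp (hη : η u = η' (τ u)) :
    localUnitNormal r η u = localUnitNormal r' η' (τ u) := by
  rw [localUnitNormal, localUnitNormal, localCovector_comp hr hr' hτ hreg hη]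

theorem localSupport_comp (hη : η u = η' (τ u)) :
    localSupport r η u = localSupport r' η' (τ u) := by
  rw [localSupport, localSupport, localCovector_comp hr hr' hτ hreg hη]

/-- The determinant of the form acquires `(det J)^4`, two factors from rescaling the normal and two
from the congruence; this matches the fourth power of the norm. -/
theorem localGaussCurvature_comp : localGaussCurvature r u = localGaussCurvature r' (τ u) := by
  have hd := det_jacobian_ne_zero_of_comp hr hr' hτ hreg
  rw [localGaussCurvature_eq, localGaussCurvature_eq, crossNormal_comp hr hr' hτ, normalForm_smul,
    normalForm_comp hr hr' hτ (inner_crossNormal_pderiv r' (τ u)), Matrix.det_smul, Matrix.det_mul,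
    Matrix.det_mul, Matrix.det_transpose, norm_smul, Fintype.card_fin, mul_inv, mul_pow, inv_pow,
    Real.norm_eq_abs, Even.pow_abs (by decide)]
  field_simp

theorem localQAff_comp : localQAff r u = localQAff r' (τ u) := by
  rw [localQAff, localQAff, localGaussCurvature_comp hr hr' hτ hreg]

theorem logSupportRatio_comp (hη : η u = η' (τ u)) :
    logSupportRatio r η u = logSupportRatio r' η' (τ u) := by
  rw [logSupportRatio, logSupportRatio, localSupport_comp hr hr' hτ hreg hη,
    localQAff_comp hr hr' hτ hreg]

end Reparametrization

end Patch

/-! ### From charts to the surface, and the global argument -/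

section Surface

variable {M : Type*} [TopologicalSpace M] [ChartedSpace E2 M]

theorem localRep_coord {F : Type*} (f : M → F) (p : M) : localRep f p (coord p) = f p := by
  rw [localRep, coord, (chartAt E2 p).left_inv (mem_chart_source E2 p)]

/-- The transition map from the preferred chart around `p` to the one around `p'`. -/
def transition (p p' : M) (u : E2) : E2 := chartAt E2 p' ((chartAt E2 p).symm u)

theorem transition_apply {p p' : M} (hp' : p' ∈ (chartAt E2 p).source) :
    transition p p' (chartAt E2 p p') = coord p' := by
  rw [transition, (chartAt E2 p).left_inv hp', coord]

theorem coord_mem_target (p : M) : coord p ∈ (chartAt E2 p).target := mem_chart_target E2 p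

theorem continuousAt_chart_symm {p p' : M} (hp' : p' ∈ (chartAt E2 p).source) :
    Filter.Tendsto (chartAt E2 p).symm (𝓝 (chartAt E2 p p')) (𝓝 p') := by
  have h := (chartAt E2 p).continuousAt_symm ((chartAt E2 p).map_source hp')
  rwa [ContinuousAt, (chartAt E2 p).left_inv hp'] at h

theorem localRep_eventuallyEq {F : Type*} (f : M → F) {p p' : M}
    (hp' : p' ∈ (chartAt E2 p).source) :
    localRep f p =ᶠ[𝓝 (chartAt E2 p p')] fun v => localRep f p' (transition p p' v) := by
  filter_upwards [(continuousAt_chart_symm hp').eventually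
    ((chartAt E2 p').open_source.mem_nhds (mem_chart_source E2 p'))] with v hv
  rw [localRep, localRep, transition, (chartAt E2 p').left_inv hv]

theorem eventually_chart {p : M} {P : M → Prop} (h : ∀ᶠ u in 𝓝 (coord p), P ((chartAt E2 p).symm u)) :
    ∀ᶠ p' in 𝓝 p, P p' := by
  filter_upwards [((chartAt E2 p).continuousAt (mem_chart_source E2 p)).eventually h,
    (chartAt E2 p).open_source.mem_nhds (mem_chart_source E2 p)] with p' h1 h2
  rwa [(chartAt E2 p).left_inv h2] at h1

variable [IsManifold (𝓡 2) 4 M]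

theorem contDiffAt_transition {p p' : M} (hp' : p' ∈ (chartAt E2 p).source) :
    ContDiffAt ℝ 4 (transition p p') (chartAt E2 p p') := by
  have h1 : ContMDiffAt (𝓡 2) (𝓡 2) 4 (chartAt E2 p).symm (chartAt E2 p p') :=
    (contMDiffOn_chart_symm (I := 𝓡 2) (x := p)).contMDiffAt
      ((chartAt E2 p).open_target.mem_nhds ((chartAt E2 p).map_source hp'))
  have h2 : ContMDiffAt (𝓡 2) (𝓡 2) 4 (chartAt E2 p')
      ((chartAt E2 p).symm (chartAt E2 p p')) := by
    rw [(chartAt E2 p).left_inv hp']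
    exact (contMDiffOn_chart (I := 𝓡 2) (x := p')).contMDiffAt
      ((chartAt E2 p').open_source.mem_nhds (mem_chart_source E2 p'))
  exact contMDiffAt_iff_contDiffAt.mp (h2.comp _ h1)

theorem contDiffAt_localRep {f : M → E3} {n : WithTop ℕ∞} (hn : n ≤ 4)
    (hf : ContMDiff (𝓡 2) (𝓡 3) n f) (p : M) {u : E2}
    (hu : u ∈ (chartAt E2 p).target) : ContDiffAt ℝ n (localRep f p) u := by
  have h1 : ContMDiffAt (𝓡 2) (𝓡 2) n (chartAt E2 p).symm u :=
    ((contMDiffOn_chart_symm (I := 𝓡 2) (x := p)).contMDiffAt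
      ((chartAt E2 p).open_target.mem_nhds hu)).of_le hn
  exact contMDiffAt_iff_contDiffAt.mp ((hf _).comp u h1)

/-- The bridge from the hypotheses on `M`, stated with `mfderiv`, to partial derivatives in a chart.
-/
theorem fderiv_localRep {f : M → E3} (hf : ContMDiff (𝓡 2) (𝓡 3) 1 f) (p : M) {u : E2}
    (hu : u ∈ (chartAt E2 p).target) (w : E2) :
    fderiv ℝ (localRep f p) u w = (mfderiv (𝓡 2) (𝓡 3) f ((chartAt E2 p).symm u)
      (mfderiv (𝓡 2) (𝓡 2) (chartAt E2 p).symm u w) : E3) := by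
  have : IsManifold (𝓡 2) 1 M := IsManifold.of_le (n := 4) (by norm_num)
  have h1 : MDifferentiableAt (𝓡 2) (𝓡 2) (chartAt E2 p).symm u :=
    (mdifferentiable_chart (I := 𝓡 2) p).mdifferentiableAt_symm hu
  have h2 : MDifferentiableAt (𝓡 2) (𝓡 3) f ((chartAt E2 p).symm u) :=
    (hf _).mdifferentiableAt (by simp)
  have h3 := mfderiv_comp u h2 h1
  have h4 : mfderiv (𝓡 2) (𝓡 3) (f ∘ (chartAt E2 p).symm) u = fderiv ℝ (localRep f p) u :=
    mfderiv_eq_fderiv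
  rw [← h4, h3]
  rfl

theorem mfderiv_chart_symm_bijective (p : M) {u : E2} (hu : u ∈ (chartAt E2 p).target) :
    Function.Bijective (mfderiv (𝓡 2) (𝓡 2) (chartAt E2 p).symm u) := by
  have : IsManifold (𝓡 2) 1 M := IsManifold.of_le (n := 4) (by norm_num)
  exact (mdifferentiable_chart (I := 𝓡 2) p).symm.mfderiv_bijective hu

variable {x y : M → E3}

theorem crossNormal_localRep_ne_zero (hx : IsImmersedSurface 4 x) (p : M) {u : E2}
    (hu : u ∈ (chartAt E2 p).target) : crossNormal (localRep x p) u ≠ 0 := by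
  have hx1 : ContMDiff (𝓡 2) (𝓡 3) 1 x := hx.contMDiff.of_le (by norm_num)
  refine crossNormal_ne_zero fun a b hab => ?_
  have h1 : fderiv ℝ (localRep x p) u !₂[a, b] = 0 := by
    rw [fderiv_eq_sum_pderiv]
    simpa using hab
  rw [fderiv_localRep hx1 p hu] at h1
  have h2 := hx.injective_mfderiv _ (h1.trans (map_zero _).symm)
  have h3 := (mfderiv_chart_symm_bijective p hu).1 (h2.trans (map_zero _).symm)
  have h4 : (!₂[a, b] : E2) = 0 := h3
  exact ⟨congrArg (fun w : E2 => w 0) h4, congrArg (fun w : E2 => w 1) h4⟩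

theorem isPatch_localRep (hx : IsImmersedSurface 4 x) (hK : ∀ p : M, 0 < gaussCurvature x p)
    (hy : IsRelativeNormalization 1 x y) (p : M) :
    IsPatch (localRep x p) (localRep y p) (chartAt E2 p).target := by
  have hx1 : ContMDiff (𝓡 2) (𝓡 3) 1 x := hx.contMDiff.of_le (by norm_num)
  have hr : ∀ u ∈ (chartAt E2 p).target, ContDiffAt ℝ 4 (localRep x p) u := fun u hu =>
    contDiffAt_localRep le_rfl hx.contMDiff p hu
  have hreg : ∀ u ∈ (chartAt E2 p).target, crossNormal (localRep x p) u ≠ 0 := fun u hu =>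
    crossNormal_localRep_ne_zero hx p hu
  refine ⟨(chartAt E2 p).open_target, hr, fun u hu =>
    contDiffAt_localRep (by norm_num) hy.contMDiff p hu, hreg, fun u hu h => ?_,
    fun u hu i => ?_, fun u hu => ?_⟩
  · obtain ⟨a, b, hab⟩ := exists_tangent_of_inner_eq_zero (hreg u hu) h
    refine hy.transversal ((chartAt E2 p).symm u)
      ⟨mfderiv (𝓡 2) (𝓡 2) (chartAt E2 p).symm u (!₂[a, b] : E2), ?_⟩
    rw [← fderiv_localRep hx1 p hu, fderiv_eq_sum_pderiv]
    exact hab.symm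
  · obtain ⟨v, hv⟩ := hy.tangent ((chartAt E2 p).symm u)
      (mfderiv (𝓡 2) (𝓡 2) (chartAt E2 p).symm u (EuclideanSpace.single i (1 : ℝ) : E2))
    obtain ⟨w, hw⟩ : ∃ w : E2, mfderiv (𝓡 2) (𝓡 2) (chartAt E2 p).symm u w = v :=
      (mfderiv_chart_symm_bijective p hu).2 v
    rw [← fderiv_localRep hy.contMDiff p hu, ← hw] at hv
    have h1 := (fderiv_localRep hx1 p hu w).trans hv
    rw [pderiv, ← h1, fderiv_eq_sum_pderiv, inner_add_right, real_inner_smul_right, real_inner_smul_right,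
      inner_crossNormal_pderiv, inner_crossNormal_pderiv]
    simp
  -- The curvature hypothesis at `p'` concerns the preferred chart of `p'`, so it has to be carried
  -- over to the chart around `p`.
  · set p' := (chartAt E2 p).symm u with hp'
    have hs : p' ∈ (chartAt E2 p).source := (chartAt E2 p).map_target hu
    have hu' : chartAt E2 p p' = u := (chartAt E2 p).right_inv hu
    have h1 := localRep_eventuallyEq x hs
    have h2 := (contDiffAt_transition hs).of_le (by norm_num : (2 : WithTop ℕ∞) ≤ 4)
    have h3 : ContDiffAt ℝ 2 (localRep x p') (transition p p' (chartAt E2 p p')) := by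
      rw [transition_apply hs]
      exact (contDiffAt_localRep le_rfl hx.contMDiff p' (coord_mem_target p')).of_le (by norm_num)
    rw [← hu', localGaussCurvature_comp h1 h3 h2 (hu' ▸ hreg u hu), transition_apply hs]
    exact hK p'

/-- The data for comparing the preferred charts around `p` and `p'`. -/
theorem localRep_transition (hx : IsImmersedSurface 4 x) {p p' : M}
    (hs : p' ∈ (chartAt E2 p).source) :
    localRep x p =ᶠ[𝓝 (chartAt E2 p p')] (fun v => localRep x p' (transition p p' v)) ∧
    ContDiffAt ℝ 2 (localRep x p') (transition p p' (chartAt E2 p p')) ∧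
    ContDiffAt ℝ 2 (transition p p') (chartAt E2 p p') ∧
    crossNormal (localRep x p) (chartAt E2 p p') ≠ 0 := by
  refine ⟨localRep_eventuallyEq x hs, ?_, (contDiffAt_transition hs).of_le (by norm_num),
    crossNormal_localRep_ne_zero hx p ((chartAt E2 p).map_source hs)⟩
  rw [transition_apply hs]
  exact (contDiffAt_localRep le_rfl hx.contMDiff p' (coord_mem_target p')).of_le (by norm_num)

/-- The logarithm of the quotient of the support functions, as a function on the surface. -/
def logRatio (x y : M → E3) (p : M) : ℝ :=
  logSupportRatio (localRep x p) (localRep y p) (coord p)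

theorem logSupportRatio_localRep (hx : IsImmersedSurface 4 x) (y : M → E3) {p p' : M}
    (hs : p' ∈ (chartAt E2 p).source) :
    logSupportRatio (localRep x p) (localRep y p) (chartAt E2 p p') = logRatio x y p' := by
  obtain ⟨h1, h2, h3, h4⟩ := localRep_transition hx hs
  rw [logSupportRatio_comp h1 h2 h3 h4 (localRep_eventuallyEq y hs).self_of_nhds,
    transition_apply hs, logRatio]

theorem support_eq (hx : IsImmersedSurface 4 x) (hK : ∀ p : M, 0 < gaussCurvature x p)
    (hy : IsRelativeNormalization 1 x y) (p : M) :
    support x y p = localSupport (localRep x p) (localRep y p) (coord p) := by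
  rw [← (isPatch_localRep hx hK hy p).inner_localUnitNormal_normalization (coord_mem_target p),
    localRep_coord]
  rfl

/-- Supplies the hypothesis of `IsPatch.metricCurvature_of_inner_eq`: only the normal component of
the equiaffine field needs comparing between charts, not the derivatives of `q_aff` in its
tangential part. -/
theorem inner_localRep_equiaffine (hx : IsImmersedSurface 4 x) (y : M → E3) {p p' : M}
    (hs : p' ∈ (chartAt E2 p).source) :
    inner ℝ (crossNormal (localRep x p) (chartAt E2 p p'))
        (localRep (equiaffine x y) p (chartAt E2 p p'))
      = localQAff (localRep x p) (chartAt E2 p p')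
        * inner ℝ (crossNormal (localRep x p) (chartAt E2 p p'))
          (localUnitNormal (localRep x p) (localRep y p) (chartAt E2 p p')) := by
  obtain ⟨h1, h2, h3, h4⟩ := localRep_transition hx hs
  rw [localUnitNormal_comp h1 h2 h3 h4 (localRep_eventuallyEq y hs).self_of_nhds,
    localQAff_comp h1 h2 h3 h4, crossNormal_comp h1 h2 h3, transition_apply hs,
    localRep, (chartAt E2 p).left_inv hs, equiaffine, real_inner_smul_left, real_inner_smul_left,
    inner_crossNormal_localEquiaffine]
  ring

/-- The difference of the normalized curvatures is a multiple of the Laplacian of the logarithm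
of the quotient of the support functions. -/
theorem relCurvature_div_sub (hx : IsImmersedSurface 4 x) (hK : ∀ p : M, 0 < gaussCurvature x p)
    (hy : IsRelativeNormalization 1 x y) (p : M) :
    relCurvature x y p / support x y p - affCurvature x y p / qAff x p
      = metricLaplacian (localRelMetric (localRep x p) (localRep y p))
          (logSupportRatio (localRep x p) (localRep y p)) (coord p) / (2 * support x y p) := by
  rw [support_eq hx hK hy]
  refine (isPatch_localRep hx hK hy p).metricCurvature_of_inner_eq (coord_mem_target p) ?_
  filter_upwards [(chartAt E2 p).open_target.mem_nhds (coord_mem_target p)] with v hv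
  have h := inner_localRep_equiaffine hx y ((chartAt E2 p).map_target hv)
  rwa [(chartAt E2 p).right_inv hv] at h

theorem localRelMetric_localRep (hx : IsImmersedSurface 4 x) (y : M → E3) {p p' : M}
    (hs : p' ∈ (chartAt E2 p).source) :
    localRelMetric (localRep x p) (localRep y p) (chartAt E2 p p')
      = (jacobian (transition p p') (chartAt E2 p p')).transpose
        * localRelMetric (localRep x p') (localRep y p') (coord p')
        * jacobian (transition p p') (chartAt E2 p p') := by
  obtain ⟨h1, h2, h3, h4⟩ := localRep_transition hx hs
  rw [localRelMetric_comp h1 h2 h3 h4 (localRep_eventuallyEq y hs).self_of_nhds,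
    transition_apply hs]

/-- The Laplacian of `logRatio` can be computed in any of the preferred charts. -/
theorem metricLaplacian_localRep (hx : IsImmersedSurface 4 x) (hK : ∀ p : M, 0 < gaussCurvature x p)
    (hy : IsRelativeNormalization 1 x y) {p p' : M} (hs : p' ∈ (chartAt E2 p).source) :
    metricLaplacian (localRelMetric (localRep x p) (localRep y p))
        (logSupportRatio (localRep x p) (localRep y p)) (chartAt E2 p p')
      = metricLaplacian (localRelMetric (localRep x p') (localRep y p'))
          (logSupportRatio (localRep x p') (localRep y p')) (coord p') := by
  obtain ⟨h1, h2, h3, h4⟩ := localRep_transition hx hs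
  have hP := isPatch_localRep hx hK hy p
  have hP' := isPatch_localRep hx hK hy p'
  have hc := transition_apply hs
  have hm := coord_mem_target p'
  have hyev := localRep_eventuallyEq y hs
  have hev : ∀ᶠ v in 𝓝 (chartAt E2 p p'), ContDiffAt ℝ 2 (localRep x p') (transition p p' v) ∧
      ContDiffAt ℝ 2 (transition p p') v ∧ crossNormal (localRep x p) v ≠ 0 := by
    refine (h3.continuousAt.eventually (h2.eventually (by simp))).and
      ((h3.eventually (by simp)).and ?_)
    filter_upwards [(chartAt E2 p).open_target.mem_nhds ((chartAt E2 p).map_source hs)] with v hv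
      using hP.regular v hv
  have hG : localRelMetric (localRep x p) (localRep y p) =ᶠ[𝓝 (chartAt E2 p p')] fun v =>
      (jacobian (transition p p') v).transpose
        * localRelMetric (localRep x p') (localRep y p') (transition p p' v)
        * jacobian (transition p p') v := by
    filter_upwards [h1.eventuallyEq_nhds, hyev, hev] with v e1 e2 e3
    exact localRelMetric_comp e1 e3.1 e3.2.1 e3.2.2 e2
  have hw : logSupportRatio (localRep x p) (localRep y p) =ᶠ[𝓝 (chartAt E2 p p')] fun v =>
      logSupportRatio (localRep x p') (localRep y p') (transition p p' v) := by
    filter_upwards [h1.eventuallyEq_nhds, hyev, hev] with v e1 e2 e3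
    exact logSupportRatio_comp e1 e3.1 e3.2.1 e3.2.2 e2
  have hm' : transition p p' (chartAt E2 p p') ∈ (chartAt E2 p').target := hc ▸ hm
  rw [metricLaplacian_congr hw, metricLaplacian_comp h3
    (fun i j => (hP'.contDiffAt_localRelMetric hm' i j).differentiableAt (by simp))
    (hP'.eventually_localRelMetric_isSymm hm') hG
    (hP.det_localRelMetric_pos ((chartAt E2 p).map_source hs)).ne'
    (hP'.contDiffAt_logSupportRatio hm'), hc]

/-- Completing the square, `P₀₀ (Jᵀ P J)₀₀` is a square plus `det P` times a square, hence
nonnegative. -/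
theorem apply_zero_pos_of_congruence {P J : Matrix (Fin 2) (Fin 2) ℝ} (hs : P.IsSymm)
    (hd : 0 < P.det) (h : 0 < (J.transpose * P * J) 0 0) : 0 < P 0 0 := by
  by_contra! hneg
  have hne : P 0 0 ≠ 0 := by
    intro h0
    rw [Matrix.det_fin_two, h0, hs.apply 0 1] at hd
    nlinarith
  have h10 : P 1 0 = P 0 1 := hs.apply 0 1
  rw [congruence_apply, h10] at h
  rw [Matrix.det_fin_two, h10] at hd
  have hlt : P 0 0 < 0 := lt_of_le_of_ne hneg hne
  nlinarith [mul_neg_of_neg_of_pos hlt h, sq_nonneg (P 0 0 * J 0 0 + P 0 1 * J 1 0),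
    mul_nonneg hd.le (sq_nonneg (J 1 0))]

theorem localRelMetric_apply_pos_iff (hx : IsImmersedSurface 4 x)
    (hK : ∀ p : M, 0 < gaussCurvature x p) (hy : IsRelativeNormalization 1 x y) {p p' : M}
    (hs : p' ∈ (chartAt E2 p).source) :
    0 < localRelMetric (localRep x p) (localRep y p) (chartAt E2 p p') 0 0
      ↔ 0 < localRelMetric (localRep x p') (localRep y p') (coord p') 0 0 := by
  have hP := isPatch_localRep hx hK hy p
  have hP' := isPatch_localRep hx hK hy p'
  have hm := coord_mem_target p'
  have hG := localRelMetric_localRep hx y hs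
  have hsym := hP'.localRelMetric_isSymm hm
  have hdet := hP'.det_localRelMetric_pos hm
  refine ⟨fun h => apply_zero_pos_of_congruence hsym hdet (hG ▸ h), fun h => ?_⟩
  by_contra! hneg
  have hlt := lt_of_le_of_ne hneg
    (hP.localRelMetric_apply_ne_zero ((chartAt E2 p).map_source hs))
  -- The converse is the same statement for the negated metrics, whose determinants are unchanged.
  have h1 := apply_zero_pos_of_congruence (J := jacobian (transition p p') (chartAt E2 p p'))
    hsym.neg (by rw [Matrix.det_neg]; simpa using hdet)
    (by rw [Matrix.mul_neg, Matrix.neg_mul, ← hG]; exact neg_pos.mpr hlt)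
  rw [Matrix.neg_apply] at h1
  linarith

/-- On a connected surface the relative metric is either positive or negative definite. -/
theorem exists_sign_posDef [PreconnectedSpace M] [Nonempty M] (hx : IsImmersedSurface 4 x)
    (hK : ∀ p : M, 0 < gaussCurvature x p) (hy : IsRelativeNormalization 1 x y) :
    ∃ σ : ℝ, σ * σ = 1 ∧ ∀ p : M, ∀ u ∈ (chartAt E2 p).target,
      (σ • localRelMetric (localRep x p) (localRep y p) u).PosDef := by
  -- As the determinant is positive, the sign of the `00` entry decides definiteness. It never
  -- vanishes and is independent of the chart, so connectedness makes it global.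
  have hloc : IsLocallyConstant fun p : M =>
      0 < localRelMetric (localRep x p) (localRep y p) (coord p) 0 0 := by
    refine (IsLocallyConstant.iff_eventually_eq _).mpr fun p => ?_
    have hP := isPatch_localRep hx hK hy p
    have hm := coord_mem_target p
    have hc := (hP.contDiffAt_localRelMetric hm 0 0).continuousAt
    have key : ∀ᶠ u in 𝓝 (coord p),
        (0 < localRelMetric (localRep x p) (localRep y p) u 0 0
          ↔ 0 < localRelMetric (localRep x p) (localRep y p) (coord p) 0 0) := by
      rcases (hP.localRelMetric_apply_ne_zero hm).lt_or_gt with h | h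
      · filter_upwards [hc.eventually (gt_mem_nhds h)] with u hu
        exact ⟨fun h' => absurd h' hu.not_gt, fun h' => absurd h' h.not_gt⟩
      · filter_upwards [hc.eventually (lt_mem_nhds h)] with u hu
        exact ⟨fun _ => h, fun _ => hu⟩
    refine eventually_chart ?_
    filter_upwards [key, (chartAt E2 p).open_target.mem_nhds hm] with u h1 h2
    have h3 := localRelMetric_apply_pos_iff hx hK hy ((chartAt E2 p).map_target h2)
    rw [(chartAt E2 p).right_inv h2] at h3
    exact propext (h3.symm.trans h1)
  obtain ⟨p₀⟩ := ‹Nonempty M›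
  have hall : ∀ p : M, ∀ u ∈ (chartAt E2 p).target,
      (0 < localRelMetric (localRep x p) (localRep y p) u 0 0
        ↔ 0 < localRelMetric (localRep x p₀) (localRep y p₀) (coord p₀) 0 0) := by
    intro p u hu
    have h3 := localRelMetric_apply_pos_iff hx hK hy ((chartAt E2 p).map_target hu)
    rw [(chartAt E2 p).right_inv hu] at h3
    exact h3.trans (iff_of_eq
      (hloc.apply_eq_of_isPreconnected isPreconnected_univ (Set.mem_univ _) (Set.mem_univ p₀)))
  by_cases h : 0 < localRelMetric (localRep x p₀) (localRep y p₀) (coord p₀) 0 0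
  · refine ⟨1, by norm_num, fun p u hu => ?_⟩
    have hP := isPatch_localRep hx hK hy p
    rw [one_smul]
    exact posDef_fin_two (hP.localRelMetric_isSymm hu) ((hall p u hu).mpr h)
      (hP.det_localRelMetric_pos hu)
  · refine ⟨-1, by norm_num, fun p u hu => ?_⟩
    have hP := isPatch_localRep hx hK hy p
    have hneg := not_lt.mp (mt (hall p u hu).mp h)
    rw [neg_one_smul]
    refine posDef_fin_two (hP.localRelMetric_isSymm hu).neg
      (neg_pos.mpr (lt_of_le_of_ne hneg (hP.localRelMetric_apply_ne_zero hu))) ?_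
    rw [Matrix.det_neg]
    simpa using hP.det_localRelMetric_pos hu

/-- Puts the Laplacian into the form of the maximum principle. The sign `σ` in the coefficients
makes them positive definite when `G` is negative definite. -/
theorem ellipticOp_const_mul_eq {G : E2 → Matrix (Fin 2) (Fin 2) ℝ} {f : E2 → ℝ} {u : E2}
    (σ c : ℝ) (hf : ContDiffAt ℝ 2 f u) :
    ellipticOp (fun v => σ • (G v)⁻¹)
        (fun k v => -∑ i, ∑ j, σ * ((G v)⁻¹ i j * christoffel G k i j v)) (fun v => c * f v) u
      = σ * c * metricLaplacian G f u := by
  have h1 : ∀ k, pderiv k (fun v => c * f v) =ᶠ[𝓝 u] fun v => c * pderiv k f v := by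
    intro k
    filter_upwards [hf.eventually (by simp)] with v hv
    rw [pderiv_const_mul c (hv.differentiableAt (by simp))]
  have h2 : ∀ k l, pderiv l (pderiv k (fun v => c * f v)) u = c * pderiv l (pderiv k f) u := by
    intro k l
    rw [pderiv_congr (h1 k), pderiv_const_mul c
      ((contDiffAt_pderiv (m := 1) hf (by norm_num) k).differentiableAt (by simp))]
  simp only [ellipticOp, metricLaplacian, metricHess, h2, (h1 _).self_of_nhds, Fin.sum_univ_two,
    Matrix.smul_apply, smul_eq_mul]
  ring

theorem continuous_logRatio (hx : IsImmersedSurface 4 x)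
    (hK : ∀ p : M, 0 < gaussCurvature x p) (hy : IsRelativeNormalization 1 x y) :
    Continuous (logRatio x y) := by
  refine continuous_iff_continuousAt.mpr fun p => ?_
  have hc := ((isPatch_localRep hx hK hy p).contDiffAt_logSupportRatio
    (coord_mem_target p)).continuousAt
  have h := ContinuousAt.comp (f := chartAt E2 p) (x := p) hc
    ((chartAt E2 p).continuousAt (mem_chart_source E2 p))
  refine h.congr ?_
  filter_upwards [(chartAt E2 p).open_source.mem_nhds (mem_chart_source E2 p)] with p' hs
  exact logSupportRatio_localRep hx y hs

/-- If the Laplacian of `logRatio` does not change sign, then `logRatio` is constant. -/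
theorem exists_logRatio_eq_const [CompactSpace M] [ConnectedSpace M] (hx : IsImmersedSurface 4 x)
    (hK : ∀ p : M, 0 < gaussCurvature x p) (hy : IsRelativeNormalization 1 x y) {s : ℝ}
    (hs : s ≠ 0)
    (hlap : ∀ p : M, 0 ≤ s * metricLaplacian (localRelMetric (localRep x p) (localRep y p))
      (logSupportRatio (localRep x p) (localRep y p)) (coord p)) :
    ∃ m : ℝ, ∀ p : M, logRatio x y p = m := by
  obtain ⟨σ, hσ, hpos⟩ := exists_sign_posDef hx hK hy
  have hσ0 : σ ≠ 0 := fun h => by simp [h] at hσ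
  -- With `σ² = 1`, the operator `σ Δ` applied to `σ s w` is `s Δ w ≥ 0`, so `σ s w` is the
  -- subsolution to maximize.
  have hcont : Continuous fun p => σ * s * logRatio x y p :=
    continuous_const.mul (continuous_logRatio hx hK hy)
  obtain ⟨p₀, -, hp₀⟩ := isCompact_univ.exists_isMaxOn (Set.univ_nonempty (α := M))
    hcont.continuousOn
  -- The maximum set is closed by continuity and open by the local maximum principle in the chart
  -- around each of its points.
  have hclopen : IsClopen {p : M | σ * s * logRatio x y p = σ * s * logRatio x y p₀} := by
    refine ⟨isClosed_eq hcont continuous_const, isOpen_iff_mem_nhds.mpr fun p hp => ?_⟩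
    have hP := isPatch_localRep hx hK hy p
    have hval : ∀ u ∈ (chartAt E2 p).target, logSupportRatio (localRep x p) (localRep y p) u
        = logRatio x y ((chartAt E2 p).symm u) := fun u hu => by
      have h := logSupportRatio_localRep hx y ((chartAt E2 p).map_target hu)
      rwa [(chartAt E2 p).right_inv hu] at h
    have hinv : ∀ u, σ • (localRelMetric (localRep x p) (localRep y p) u)⁻¹
        = (σ • localRelMetric (localRep x p) (localRep y p) u)⁻¹ := by
      intro u
      have hσi : σ⁻¹ = σ := inv_eq_of_mul_eq_one_left hσ
      rw [inv_fin_two, inv_fin_two, Matrix.det_smul, Fintype.card_fin, pow_two, hσ, one_mul]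
      ext i j
      fin_cases i <;> fin_cases j <;> simp <;> ring
    have hG : ∀ u ∈ (chartAt E2 p).target, ∀ i j, ContinuousAt
        (fun v => (localRelMetric (localRep x p) (localRep y p) v)⁻¹ i j) u := fun u hu i j =>
      (contDiffAt_inv (hP.contDiffAt_localRelMetric hu)
        (hP.det_localRelMetric_pos hu).ne' i j).continuousAt
    have hΓ : ∀ u ∈ (chartAt E2 p).target, ∀ k i j, ContinuousAt
        (christoffel (localRelMetric (localRep x p) (localRep y p)) k i j) u := fun u hu k i j =>
      (contDiffAt_christoffel (m := 1) (hP.contDiffAt_localRelMetric hu) (by norm_num)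
        (hP.det_localRelMetric_pos hu).ne' k i j).continuousAt
    have hmax := eventually_eq_of_isMaxOn (w := fun v => σ * s *
        logSupportRatio (localRep x p) (localRep y p) v)
      (A := fun v => σ • (localRelMetric (localRep x p) (localRep y p) v)⁻¹)
      (B := fun k v => -∑ i, ∑ j, σ * ((localRelMetric (localRep x p) (localRep y p) v)⁻¹ i j
        * christoffel (localRelMetric (localRep x p) (localRep y p)) k i j v))
      (chartAt E2 p).open_target (coord_mem_target p)
      (fun u hu => contDiffAt_const.mul (hP.contDiffAt_logSupportRatio hu))
      (fun i j u hu => (continuousAt_const.mul (hG u hu i j)).continuousWithinAt)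
      (fun k u hu => ContinuousAt.continuousWithinAt (ContinuousAt.neg
        (tendsto_finsetSum _ fun i _ => tendsto_finsetSum _ fun j _ =>
          continuousAt_const.mul ((hG u hu i j).mul (hΓ u hu k i j)))))
      (fun u hu => by
        show (σ • (localRelMetric (localRep x p) (localRep y p) u)⁻¹).PosDef
        rw [hinv]
        exact (hpos p u hu).inv)
      (fun u hu => by
        rw [ellipticOp_const_mul_eq σ _ (hP.contDiffAt_logSupportRatio hu)]
        have h := metricLaplacian_localRep hx hK hy ((chartAt E2 p).map_target hu)
        rw [(chartAt E2 p).right_inv hu] at h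
        rw [h]
        have h' := hlap ((chartAt E2 p).symm u)
        have e : σ * (σ * s) = s := by linear_combination s * hσ
        rwa [e])
      (fun u hu => by
        rw [hval u hu]
        have h1 : σ * s * logRatio x y ((chartAt E2 p).symm u) ≤ σ * s * logRatio x y p₀ :=
          hp₀ (Set.mem_univ _)
        have h2 : σ * s * logRatio x y p = σ * s * logRatio x y p₀ := hp
        exact h1.trans h2.symm.le)
    refine eventually_chart ?_
    filter_upwards [hmax, (chartAt E2 p).open_target.mem_nhds (coord_mem_target p)] with u h1 hu
    rw [hval u hu] at h1
    exact h1.trans hp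
  refine ⟨logRatio x y p₀, fun p => ?_⟩
  have h : p ∈ {p : M | σ * s * logRatio x y p = σ * s * logRatio x y p₀} := by
    rw [hclopen.eq_univ ⟨p₀, rfl⟩]
    trivial
  exact mul_left_cancel₀ (mul_ne_zero hσ0 hs) h

theorem eq_smul_equiaffine (hx : IsImmersedSurface 4 x)
    (hK : ∀ p : M, 0 < gaussCurvature x p) (hy : IsRelativeNormalization 1 x y) {m : ℝ}
    (hm : ∀ p : M, logRatio x y p = m) (p : M) : y p = Real.exp m • equiaffine x y p := by
  have hP := isPatch_localRep hx hK hy p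
  rw [← localRep_coord y p, equiaffine]
  refine hP.eq_smul_localEquiaffine (coord_mem_target p) ?_
  filter_upwards [(chartAt E2 p).open_target.mem_nhds (coord_mem_target p)] with u hu
  have h := logSupportRatio_localRep hx y ((chartAt E2 p).map_target hu)
  rw [(chartAt E2 p).right_inv hu, hm] at h
  rw [← h, hP.exp_logSupportRatio hu, div_mul_cancel₀ _ (hP.localQAff_pos hu).ne']

end Surface

end RelGeom

end


/-! ### Conclusion: a Laplacian of one sign forces proportionality -/

theorem proposition7 {M : Type*} [TopologicalSpace M] [ChartedSpace RelGeom.E2 M]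
    [IsManifold (𝓡 2) 4 M] [T2Space M] [CompactSpace M] [ConnectedSpace M]
    (x y : M → RelGeom.E3)
    (hx : RelGeom.IsImmersedSurface 4 x)
    (hK : ∀ p : M, 0 < RelGeom.gaussCurvature x p)
    (hy : RelGeom.IsRelativeNormalization 1 x y)
    (hS : (∀ p : M, 0 ≤ RelGeom.relCurvature x y p / RelGeom.support x y p
              - RelGeom.affCurvature x y p / RelGeom.qAff x p) ∨
          (∀ p : M, RelGeom.relCurvature x y p / RelGeom.support x y p
              - RelGeom.affCurvature x y p / RelGeom.qAff x p ≤ 0)) :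
    ∃ c : ℝ, c ≠ 0 ∧ ∀ p : M, y p = c • RelGeom.equiaffine x y p := by
  have hq : ∀ p : M, 0 < RelGeom.support x y p := fun p => by
    rw [RelGeom.support_eq hx hK hy]
    exact (RelGeom.isPatch_localRep hx hK hy p).localSupport_pos (RelGeom.coord_mem_target p)
  obtain ⟨m, hm⟩ : ∃ m : ℝ, ∀ p : M, RelGeom.logRatio x y p = m := by
    simp only [RelGeom.relCurvature_div_sub hx hK hy] at hS
    -- Multiplying by `2 q > 0` leaves the sign of the Laplacian; the choice `s = ±1` treats both
    -- cases as one.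
    rcases hS with hS | hS
    · refine RelGeom.exists_logRatio_eq_const hx hK hy (s := 1) one_ne_zero fun p => ?_
      have h := mul_nonneg (hS p) (mul_pos two_pos (hq p)).le
      rw [div_mul_cancel₀ _ (mul_pos two_pos (hq p)).ne'] at h
      linarith
    · refine RelGeom.exists_logRatio_eq_const hx hK hy (s := -1) (by norm_num) fun p => ?_
      have h := mul_nonpos_of_nonpos_of_nonneg (hS p) (mul_pos two_pos (hq p)).le
      rw [div_mul_cancel₀ _ (mul_pos two_pos (hq p)).ne'] at h
      linarith
  exact ⟨Real.exp m, (Real.exp_pos m).ne', RelGeom.eq_smul_equiaffine hx hK hy hm⟩
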